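/- Let $V$ be a right $\mathbb{H}$-module of finite dimension $n=\dim_{\mathbb H}V$. For a right $\mathbb{H}$-module $W$ of dimension $n$ let $\bar W$ be the left module with the same vectors and $q\cdot w:=w\cdot\bar q$, let $\sigma(x\otimes y)=y\otimes x$ on $W\otimes_{\mathbb H}\bar W$, and put $S^k(W)=\mathrm{Sym}^k_{\mathbb R}\big((W\otimes_{\mathbb H}\bar W)^\sigma\big)$. The space $S^n(W)$ has a unique $\mathrm{Aut}_{\mathbb H}(W)$-invariant subspace of real codimension $1$; let $M$ be the quotient map by it, let $L^k(W)=\{x\in S^k(W): M(xy)=0\ \forall y\in S^{n-k}(W)\}$ and $R^k(W)=S^k(W)/L^k(W)$ for $0\le k\le n$. Put $\Omega^{k,k}(V)=R^k(\overline{V^*})$, where $V^*=\mathrm{Hom}_{\mathbb H}(V,\mathbb H)$ and $\overline{V^*}$ is the right module $\varphi\cdot q:=\bar q\varphi$; these spaces carry the product induced by the symmetric algebra and are contravariant in $V$. For an $\mathbb H$-basis of $V$ with coordinates $\varphi_1,\dots,\varphi_n$, a hyperhermitian matrix $A=(a_{ij})$ (i.e. $a_{ij}=\overline{a_{ji}}$)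 defines the class $[A]\in\Omega^{1,1}(V)$ of $\sum_{i,j}\varphi_i\otimes a_{ij}\varphi_j$, which corresponds to the form $\sum_{i,j}\bar x_ia_{ij}y_j$. The half line $\Omega^{n,n}(V)_{\ge0}$ consists of the non-negative multiples of $[\mathrm{Id}]^n$ (it does not depend on the basis). An element of $\Omega^{k,k}(V)$ is strongly positive if it is a finite sum of elements $f^*\xi$ with $f:V\to U$ a morphism of right $\mathbb H$-modules, $\dim_{\mathbb H}U=k$, $\xi\in\Omega^{k,k}(U)_{\ge0}$; an element $\eta\in\Omega^{k,k}(V)$ is weakly positive if $\eta\cdot\zeta\in\Omega^{n,n}(V)_{\ge0}$ for every strongly positive $\zeta\in\Omega^{n-k,n-k}(V)$. Let $C^k(V)$ and $K^k(V)$ be the sets of strongly and of weakly positive elements of $\Omega^{k,k}(V)$. Let $\mathcal H_n$ be the real vector space of hyperhermitian $n\times n$ matrices, $\mathcal C\subset\mathcal H_n$ the cone of non-negative definite ones ($\xi^*A\xi\ge0$ for all $\xi\in\mathbb H^n$), and $(X,Y)=\mathrm{Re}\sum_i(XY)_{ii}$ on $\mathcal H_n$. 1. For each $k\in\{0,1,n-1,n\}$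 with $0\le k\le n$ one has $K^k(V)=C^k(V)$. 2. The cone $\mathcal C$ is self-dual: $\mathcal C=\{X\in\mathcal H_n:\ (X,Y)\ge0\ \ \forall Y\in\mathcal C\}$. 3. If $n\ge1$, then for every $\mathbb H$-basis of $V$ the map $A\mapsto[A]$ is a bijection $\mathcal H_n\to\Omega^{1,1}(V)$ that takes $\mathcal C$ onto $C^1(V)=K^1(V)$. 4. If $n\ge1$, then for every $\mathbb H$-basis of $V$ there are linear isomorphisms $\tau:\Omega^{n,n}(V)\to\mathbb R$ with $\tau([\mathrm{Id}]^n)=1$ and $\Psi:\Omega^{n-1,n-1}(V)\to\mathcal H_n$ with $\tau(\eta\cdot[X])=(\Psi(\eta),X)$ for all $\eta\in\Omega^{n-1,n-1}(V)$ and $X\in\mathcal H_n$, and $\Psi$ takes $C^{n-1}(V)=K^{n-1}(V)$ onto $\mathcal C$. -/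

import Mathlib

open scoped TensorProduct Quaternion
open MulOpposite

universe u v

noncomputable section

namespace QuatForms

/-! A right `ℍ`-module is a module over `ℍ[ℝ]ᵐᵒᵖ`: the vector `w · q` is `op q • w`. -/

/-! ### The tensor product `W ⊗_ℍ W̄` and the algebra `R(W)` -/

section Tensor

variable (W : Type u) [AddCommGroup W] [Module ℝ W] [Module ℍ[ℝ]ᵐᵒᵖ W]

/-- The relations `(w · q) ⊗ w' = w ⊗ (q · w')` of `W ⊗_ℍ W̄`. Here `W̄` is the left module with
the same vectors as `W` and the scalar multiplication `q · w' := w' · q̄`. -/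
def balancedRel : Submodule ℝ (W ⊗[ℝ] W) :=
  Submodule.span ℝ
    {t | ∃ (w w' : W) (q : ℍ[ℝ]), t = (op q • w) ⊗ₜ[ℝ] w' - w ⊗ₜ[ℝ] (op (star q) • w')}

/-- `W ⊗_ℍ W̄`, as a real vector space. -/
abbrev TensorConj : Type u := (W ⊗[ℝ] W) ⧸ balancedRel W

theorem balancedRel_le_comap_comm :
    balancedRel W ≤ (balancedRel W).comap (TensorProduct.comm ℝ W W).toLinearMap := by
  refine Submodule.span_le.2 ?_
  rintro _ ⟨w, w', q, rfl⟩
  have h : (op (star q) • w') ⊗ₜ[ℝ] w - w' ⊗ₜ[ℝ] (op (star (star q)) • w) ∈ balancedRel W :=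
    Submodule.subset_span ⟨w', w, star q, rfl⟩
  rw [star_star] at h
  have h' := (balancedRel W).neg_mem h
  simpa using h'

/-- The involution `σ (x ⊗ y) = y ⊗ x` of `W ⊗_ℍ W̄`. -/
def sigma : TensorConj W →ₗ[ℝ] TensorConj W :=
  (balancedRel W).mapQ (balancedRel W) (TensorProduct.comm ℝ W W).toLinearMap
    (balancedRel_le_comap_comm W)

/-- The fixed subspace `(W ⊗_ℍ W̄)^σ`. -/
def sigmaFixed : Submodule ℝ (TensorConj W) := LinearMap.eqLocus (sigma W) LinearMap.id

/-- `Sym^• ((W ⊗_ℍ W̄)^σ)`. -/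
abbrev SymAlg : Type u := SymmetricAlgebra ℝ (sigmaFixed W)

/-- `Sym^k ((W ⊗_ℍ W̄)^σ)`, the homogeneous part of degree `k`. -/
def symPow (k : ℕ) : Submodule ℝ (SymAlg W) :=
  LinearMap.range (SymmetricAlgebra.ι ℝ (sigmaFixed W)) ^ k

end Tensor

/-! ### Functoriality in `W` -/

section Functor

variable {W₁ : Type u} [AddCommGroup W₁] [Module ℝ W₁] [Module ℍ[ℝ]ᵐᵒᵖ W₁]
  [IsScalarTower ℝ ℍ[ℝ]ᵐᵒᵖ W₁]
  {W₂ : Type v} [AddCommGroup W₂] [Module ℝ W₂] [Module ℍ[ℝ]ᵐᵒᵖ W₂]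
  [IsScalarTower ℝ ℍ[ℝ]ᵐᵒᵖ W₂]

theorem balancedRel_le_comap_map (f : W₁ →ₗ[ℍ[ℝ]ᵐᵒᵖ] W₂) :
    balancedRel W₁ ≤ (balancedRel W₂).comap
      (TensorProduct.map (f.restrictScalars ℝ) (f.restrictScalars ℝ)) := by
  refine Submodule.span_le.2 ?_
  rintro _ ⟨w, w', q, rfl⟩
  have h : (op q • f w) ⊗ₜ[ℝ] f w' - f w ⊗ₜ[ℝ] (op (star q) • f w') ∈ balancedRel W₂ :=
    Submodule.subset_span ⟨f w, f w', q, rfl⟩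
  simpa using h

/-- The map `x ⊗ y ↦ f x ⊗ f y`. -/
def tensorMap (f : W₁ →ₗ[ℍ[ℝ]ᵐᵒᵖ] W₂) : TensorConj W₁ →ₗ[ℝ] TensorConj W₂ :=
  (balancedRel W₁).mapQ (balancedRel W₂)
    (TensorProduct.map (f.restrictScalars ℝ) (f.restrictScalars ℝ)) (balancedRel_le_comap_map f)

theorem sigma_tensorMap (f : W₁ →ₗ[ℍ[ℝ]ᵐᵒᵖ] W₂) (t : TensorConj W₁) :
    sigma W₂ (tensorMap f t) = tensorMap f (sigma W₁ t) := by
  obtain ⟨t, rfl⟩ := Submodule.Quotient.mk_surjective _ t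
  simp only [sigma, tensorMap, Submodule.mapQ_apply, LinearEquiv.coe_coe]
  congr 1
  induction t using TensorProduct.induction_on with
  | zero => simp
  | tmul x y => simp
  | add x y hx hy => simp only [map_add, hx, hy]

/-- The map induced on the `σ`-fixed parts. -/
def sigmaFixedMap (f : W₁ →ₗ[ℍ[ℝ]ᵐᵒᵖ] W₂) : sigmaFixed W₁ →ₗ[ℝ] sigmaFixed W₂ :=
  (tensorMap f).restrict fun t ht => by
    have ht' : sigma W₁ t = t := ht
    change sigma W₂ (tensorMap f t) = tensorMap f t
    rw [sigma_tensorMap, ht']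

/-- The induced homomorphism of symmetric algebras. -/
def symAlgMap (f : W₁ →ₗ[ℍ[ℝ]ᵐᵒᵖ] W₂) : SymAlg W₁ →ₐ[ℝ] SymAlg W₂ :=
  SymmetricAlgebra.lift (SymmetricAlgebra.ι ℝ (sigmaFixed W₂) ∘ₗ sigmaFixedMap f)

theorem symAlgMap_mem (f : W₁ →ₗ[ℍ[ℝ]ᵐᵒᵖ] W₂) (k : ℕ) {x : SymAlg W₁} (hx : x ∈ symPow W₁ k) :
    symAlgMap f x ∈ symPow W₂ k := by
  have h : (symPow W₁ k).map (symAlgMap f).toLinearMap ≤ symPow W₂ k := by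
    rw [symPow, symPow, Submodule.map_pow]
    refine pow_le_pow_left' ?_ k
    rintro _ ⟨_, ⟨t, rfl⟩, rfl⟩
    exact ⟨sigmaFixedMap f t, by simp [symAlgMap]⟩
  exact h ⟨x, hx, rfl⟩

/-- The induced map on `Sym^k`. -/
def symPowMap (f : W₁ →ₗ[ℍ[ℝ]ᵐᵒᵖ] W₂) (k : ℕ) : symPow W₁ k →ₗ[ℝ] symPow W₂ k :=
  (symAlgMap f).toLinearMap.restrict fun _ hx => symAlgMap_mem f k hx

end Functor

/-! ### The Moore map and the spaces `R^k(W)` -/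

section Moore

variable (W : Type u) [AddCommGroup W] [Module ℝ W] [Module ℍ[ℝ]ᵐᵒᵖ W]
  [IsScalarTower ℝ ℍ[ℝ]ᵐᵒᵖ W]

/-- `N` is an `Aut_ℍ W`-invariant subspace of real codimension one in `Sym^n ((W ⊗_ℍ W̄)^σ)`. -/
def IsInvariantHyperplane (n : ℕ) (N : Submodule ℝ (symPow W n)) : Prop :=
  (∀ g : W ≃ₗ[ℍ[ℝ]ᵐᵒᵖ] W, ∀ x ∈ N, symPowMap g.toLinearMap n x ∈ N) ∧
    Module.finrank ℝ (symPow W n ⧸ N) = 1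

/-- The kernel of the Moore map `Sym^n ((W ⊗_ℍ W̄)^σ) → M(W)`. For `n = dim_ℍ W` there is exactly
one invariant hyperplane, so that the infimum is this hyperplane. -/
def mooreKernel (n : ℕ) : Submodule ℝ (symPow W n) :=
  sInf {N | IsInvariantHyperplane W n N}

variable {W} in
/-- The product `Sym^k × Sym^l → Sym^{k+l}`. -/
def symMul {k l : ℕ} (x : symPow W k) (y : symPow W l) : symPow W (k + l) :=
  ⟨x.1 * y.1, by
    have h := Submodule.mul_mem_mul x.2 y.2
    unfold symPow at h ⊢
    rwa [← pow_add] at h⟩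

/-- `L^k(W)`: the `x ∈ Sym^k` with `M (x · y) = 0` for all `y ∈ Sym^{n-k}`, `n = dim_ℍ W`.
(For `k > n` this is all of `Sym^k`.) -/
def leftKernel (k : ℕ) : Submodule ℝ (symPow W k) where
  carrier := {x | ∀ l : ℕ, k + l = Module.finrank ℍ[ℝ]ᵐᵒᵖ W → ∀ y : symPow W l,
    symMul x y ∈ mooreKernel W (k + l)}
  zero_mem' := fun l _ y => by
    have h : symMul (0 : symPow W k) y = 0 := Subtype.ext (by simp [symMul])
    rw [h]
    exact zero_mem _
  add_mem' := fun {a b} ha hb l hl y => by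
    have h : symMul (a + b) y = symMul a y + symMul b y :=
      Subtype.ext (by simp [symMul, add_mul])
    rw [h]
    exact add_mem (ha l hl y) (hb l hl y)
  smul_mem' := fun c a ha l hl y => by
    have h : symMul (c • a) y = c • symMul a y := Subtype.ext (by simp [symMul])
    rw [h]
    exact Submodule.smul_mem _ c (ha l hl y)

/-- `R^k(W) = Sym^k ((W ⊗_ℍ W̄)^σ) / L^k(W)`. -/
abbrev RSpace (k : ℕ) : Type u := symPow W k ⧸ leftKernel W k

theorem symMul_mem_leftKernel {k l : ℕ} {x : symPow W k} (hx : x ∈ leftKernel W k)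
    (y : symPow W l) : symMul x y ∈ leftKernel W (k + l) := by
  intro m hm z
  have h := hx (l + m) (by omega) (symMul y z)
  have key : ∀ (p q : ℕ) (_ : p = q) (s : symPow W p) (t : symPow W q), s.1 = t.1 →
      s ∈ mooreKernel W p → t ∈ mooreKernel W q := by
    rintro p q rfl s t hst hs
    rwa [← Subtype.ext hst]
  exact key _ _ (by omega) _ _ (by simp [symMul, mul_assoc]) h

theorem symMul_mem_leftKernel' {k l : ℕ} (x : symPow W k) {y : symPow W l}
    (hy : y ∈ leftKernel W l) : symMul x y ∈ leftKernel W (k + l) := by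
  have key : ∀ (p q : ℕ) (_ : p = q) (s : symPow W p) (t : symPow W q), s.1 = t.1 →
      s ∈ leftKernel W p → t ∈ leftKernel W q := by
    rintro p q rfl s t hst hs
    rwa [← Subtype.ext hst]
  exact key _ _ (by omega) _ _ (by simp [symMul, mul_comm]) (symMul_mem_leftKernel W hy x)

variable {W} in
/-- The product `R^k(W) × R^l(W) → R^{k+l}(W)`. -/
def RSpace.mul {k l : ℕ} (x : RSpace W k) (y : RSpace W l) : RSpace W (k + l) :=
  Quotient.map₂ (sc := (leftKernel W (k + l)).quotientRel) symMul (by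
    intro a a' ha b b' hb
    have ha := (Submodule.quotientRel_def _).1 ha
    have hb := (Submodule.quotientRel_def _).1 hb
    refine (Submodule.quotientRel_def _).2 ?_
    have h : symMul a b - symMul a' b' = symMul (a - a') b + symMul a' (b - b') :=
      Subtype.ext (by simp [symMul, sub_mul, mul_sub])
    rw [h]
    exact add_mem (symMul_mem_leftKernel W ha b) (symMul_mem_leftKernel' W a' hb)) x y

end Moore

/-! ### The spaces `Ω^{k,k}(V)` -/

/-- The right `ℍ`-module conjugate to the left `ℍ`-module `V^* = Hom_ℍ(V, ℍ)`. -/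
def ConjDual (V : Type u) [AddCommGroup V] [Module ℍ[ℝ]ᵐᵒᵖ V] : Type u :=
  V →ₗ[ℍ[ℝ]ᵐᵒᵖ] ℍ[ℝ]

section Forms

variable (V : Type u) [AddCommGroup V] [Module ℍ[ℝ]ᵐᵒᵖ V]

instance : AddCommGroup (ConjDual V) :=
  inferInstanceAs (AddCommGroup (V →ₗ[ℍ[ℝ]ᵐᵒᵖ] ℍ[ℝ]))

instance : Module ℝ (ConjDual V) :=
  inferInstanceAs (Module ℝ (V →ₗ[ℍ[ℝ]ᵐᵒᵖ] ℍ[ℝ]))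

/-- The left multiplication `(q φ)(v) = q φ(v)` on `V^*`. -/
def leftSMul {V : Type u} [AddCommGroup V] [Module ℍ[ℝ]ᵐᵒᵖ V] (q : ℍ[ℝ]) (φ : ConjDual V) :
    ConjDual V :=
  (q • (show V →ₗ[ℍ[ℝ]ᵐᵒᵖ] ℍ[ℝ] from φ) : V →ₗ[ℍ[ℝ]ᵐᵒᵖ] ℍ[ℝ])

/-- The right module structure of the conjugate space: `φ · q := q̄ φ`. -/
instance : Module ℍ[ℝ]ᵐᵒᵖ (ConjDual V) where
  smul q φ := leftSMul (star (unop q)) φ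
  one_smul φ := by
    refine LinearMap.ext fun v => ?_
    change star (1 : ℍ[ℝ]) * _ = _
    rw [star_one, one_mul]
  mul_smul p q φ := by
    refine LinearMap.ext fun v => ?_
    change star (unop q * unop p) * _ = star (unop p) * (star (unop q) * _)
    rw [star_mul, mul_assoc]
  smul_zero q := by
    refine LinearMap.ext fun v => ?_
    change star (unop q) * (0 : ℍ[ℝ]) = 0
    rw [mul_zero]
  smul_add q φ ψ := by
    refine LinearMap.ext fun v => ?_
    exact mul_add _ _ _
  add_smul p q φ := by
    refine LinearMap.ext fun v => ?_
    change star (unop p + unop q) * _ = _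
    rw [star_add]
    exact add_mul _ _ _
  zero_smul φ := by
    refine LinearMap.ext fun v => ?_
    change star (0 : ℍ[ℝ]) * _ = (0 : ℍ[ℝ])
    rw [star_zero, zero_mul]

instance : IsScalarTower ℝ ℍ[ℝ]ᵐᵒᵖ (ConjDual V) where
  smul_assoc r q φ := by
    refine LinearMap.ext fun v => ?_
    change star (r • unop q) * _ = r • (star (unop q) * _)
    rw [Quaternion.star_smul, smul_mul_assoc]

/-- `Ω^{k,k}(V) = R^k` of the conjugate dual of `V`. -/
abbrev Omega (k : ℕ) : Type u := RSpace (ConjDual V) k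

/-- The class in `Ω^{k,k}(V)` of an element of `Sym^k`. -/
def Omega.mk {V : Type u} [AddCommGroup V] [Module ℍ[ℝ]ᵐᵒᵖ V] (k : ℕ) :
    symPow (ConjDual V) k →ₗ[ℝ] Omega V k :=
  (leftKernel (ConjDual V) k).mkQ

variable {V} {U : Type v} [AddCommGroup U] [Module ℍ[ℝ]ᵐᵒᵖ U]

/-- The transpose `φ ↦ φ ∘ f` of a morphism `f : V → U`. -/
def conjDualMap (f : V →ₗ[ℍ[ℝ]ᵐᵒᵖ] U) : ConjDual U →ₗ[ℍ[ℝ]ᵐᵒᵖ] ConjDual V where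
  toFun φ := LinearMap.comp (show U →ₗ[ℍ[ℝ]ᵐᵒᵖ] ℍ[ℝ] from φ) f
  map_add' _ _ := rfl
  map_smul' _ _ := rfl

/-- `η = f^* ξ` for `f : V → U`, `ξ ∈ Ω^{k,k}(U)`, `η ∈ Ω^{k,k}(V)`: the map that `f` induces
from `Sym^k` of `U` to `Sym^k` of `V` takes a representative of `ξ` to a representative of `η`. -/
def IsPullback (f : V →ₗ[ℍ[ℝ]ᵐᵒᵖ] U) (k : ℕ) (ξ : Omega U k) (η : Omega V k) : Prop :=
  ∃ x : symPow (ConjDual U) k,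
    Omega.mk k x = ξ ∧ Omega.mk k (symPowMap (conjDualMap f) k x) = η

end Forms

/-! ### Hyperhermitian matrices -/

/-- The real vector space `ℋ_n` of hyperhermitian matrices: `a_{ij}` is the conjugate of
`a_{ji}`. -/
def HypHerm (n : ℕ) : Submodule ℝ (Matrix (Fin n) (Fin n) ℍ[ℝ]) where
  carrier := {A | ∀ i j, A i j = star (A j i)}
  zero_mem' := fun i j => by simp
  add_mem' := fun {A B} hA hB i j => by
    rw [Matrix.add_apply, Matrix.add_apply, star_add, ← hA i j, ← hB i j]
  smul_mem' := fun c A hA i j => by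
    rw [Matrix.smul_apply, Matrix.smul_apply, Quaternion.star_smul, ← hA i j]

/-- The identity matrix. -/
def HypHerm.id (n : ℕ) : HypHerm n := 
  ⟨1, fun i j => by
    rcases eq_or_ne i j with rfl | h
    · simp
    · simp [Matrix.one_apply_ne h, Matrix.one_apply_ne h.symm]⟩

/-- The cone of non-negative definite hyperhermitian matrices: `ξ^* A ξ` is a real number `≥ 0`
for every column `ξ`. -/
def nonnegCone (n : ℕ) : Set (HypHerm n) :=
  {A | ∀ ξ : Fin n → ℍ[ℝ], ∃ r : ℝ, 0 ≤ r ∧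
    ∑ i, ∑ j, star (ξ i) * A.1 i j * ξ j = (r : ℍ[ℝ])}

/-- `Tr (X · Y) = Re ∑ i, (X Y)_{ii}`. -/
def traceForm {n : ℕ} (X Y : HypHerm n) : ℝ := (∑ i, (X.1 * Y.1) i i).re

section Matrices

variable {V : Type u} [AddCommGroup V] [Module ℍ[ℝ]ᵐᵒᵖ V] {n : ℕ}

/-- The `i`-th coordinate `v = ∑ i, e_i · q_i ↦ q_i` with respect to a basis. -/
def coordForm (b : Module.Basis (Fin n) ℍ[ℝ]ᵐᵒᵖ V) (i : Fin n) : ConjDual V where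
  toFun v := unop (b.repr v i)
  map_add' x y := by simp
  map_smul' c x := by simp [MulOpposite.smul_eq_mul_unop]

/-- The element `∑ φ_i ⊗ a_{ij} φ_j` of `(W ⊗_ℍ W̄)^σ` (`W` the conjugate dual of `V`, `φ_i` the
coordinates) that corresponds to the hyperhermitian form `B(x, y) = ∑ x̄_i a_{ij} y_j`. -/
def matrixForm (b : Module.Basis (Fin n) ℍ[ℝ]ᵐᵒᵖ V) :
    HypHerm n →ₗ[ℝ] sigmaFixed (ConjDual V) where
  toFun A := ⟨(balancedRel (ConjDual V)).mkQ
      (∑ i, ∑ j, coordForm b i ⊗ₜ[ℝ] leftSMul (A.1 i j) (coordForm b j)), by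
    suffices h : sigma (ConjDual V) ((balancedRel (ConjDual V)).mkQ
        (∑ i, ∑ j, coordForm b i ⊗ₜ[ℝ] leftSMul (A.1 i j) (coordForm b j))) =
        (balancedRel (ConjDual V)).mkQ
        (∑ i, ∑ j, coordForm b i ⊗ₜ[ℝ] leftSMul (A.1 i j) (coordForm b j)) from h
    have hA : ∀ i j, star (A.1 i j) = A.1 j i := fun i j => (A.2 j i).symm
    have hs : ∀ (q : ℍ[ℝ]) (φ : ConjDual V), op (star q) • φ = leftSMul q φ := fun q φ => by
      change leftSMul (star (star q)) φ = _
      rw [star_star]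
    simp only [map_sum]
    rw [Finset.sum_comm]
    refine Finset.sum_congr rfl fun i _ => Finset.sum_congr rfl fun j _ => ?_
    rw [← hs (A.1 j i), ← hs (A.1 i j), ← hA j i, star_star, sigma]
    simp only [Submodule.mkQ_apply, Submodule.mapQ_apply, LinearEquiv.coe_coe,
      TensorProduct.comm_tmul]
    rw [Submodule.Quotient.eq]
    refine Submodule.subset_span ⟨coordForm b i, coordForm b j, star (A.1 j i), ?_⟩
    rw [star_star]⟩
  map_add' A B := by
    refine Subtype.ext ?_
    have h : ∀ (p q : ℍ[ℝ]) (φ : ConjDual V), leftSMul (p + q) φ = leftSMul p φ + leftSMul q φ :=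
      fun p q φ => LinearMap.ext fun v => add_mul _ _ _
    simp only [Submodule.coe_add, Matrix.add_apply, h, TensorProduct.tmul_add,
      Finset.sum_add_distrib, map_add]
  map_smul' r A := by
    refine Subtype.ext ?_
    have h : ∀ (q : ℍ[ℝ]) (φ : ConjDual V), leftSMul (r • q) φ = r • leftSMul q φ :=
      fun q φ => LinearMap.ext fun v => smul_mul_assoc _ _ _
    simp [h, Finset.smul_sum]

/-- The class in `Ω^{1,1}(V)` of the hyperhermitian form with the given matrix. -/
def matrixToOmega (b : Module.Basis (Fin n) ℍ[ℝ]ᵐᵒᵖ V) : HypHerm n →ₗ[ℝ] Omega V 1 :=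
  Omega.mk 1 ∘ₗ ((SymmetricAlgebra.ι ℝ (sigmaFixed (ConjDual V))).codRestrict
    (symPow (ConjDual V) 1) fun t => by
      rw [symPow, pow_one]
      exact LinearMap.mem_range_self _ t) ∘ₗ matrixForm b

/-- The class of `(Id)^m` in `Ω^{m,m}(V)`, where `Id` is the form with the identity matrix. -/
def idPow (b : Module.Basis (Fin n) ℍ[ℝ]ᵐᵒᵖ V) (m : ℕ) : Omega V m :=
  Omega.mk m ⟨SymmetricAlgebra.ι ℝ (sigmaFixed (ConjDual V)) (matrixForm b (HypHerm.id n)) ^ m,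
    Submodule.pow_mem_pow _ (LinearMap.mem_range_self _ _) m⟩

/-! ### Positivity -/

variable (V)

/-- The half line `Ω^{n,n}(V)_{≥ 0}`, where `n = dim_ℍ V`. -/
def topNonneg (n : ℕ) : Set (Omega V n) :=
  {ω | ∃ (b : Module.Basis (Fin n) ℍ[ℝ]ᵐᵒᵖ V) (t : ℝ), 0 ≤ t ∧ ω = t • idPow b n}

/-- The elements `f^* ξ` with `f : V → U`, `dim_ℍ U = k`, `ξ ∈ Ω^{k,k}(U)_{≥ 0}`. -/
def simplePositive (k : ℕ) : Set (Omega V k) :=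
  {η | ∃ (U : Type u) (_ : AddCommGroup U) (_ : Module ℍ[ℝ]ᵐᵒᵖ U)
    (_ : Module.Finite ℍ[ℝ]ᵐᵒᵖ U) (f : V →ₗ[ℍ[ℝ]ᵐᵒᵖ] U) (ξ : Omega U k),
    Module.finrank ℍ[ℝ]ᵐᵒᵖ U = k ∧ ξ ∈ topNonneg U k ∧ IsPullback f k ξ η}

/-- `C^k(V)`: the strongly positive elements of `Ω^{k,k}(V)`, i.e. the finite sums of elements
`f^* ξ` as above. -/
def strongCone (k : ℕ) : Set (Omega V k) :=
  {η | η ∈ AddSubmonoid.closure (simplePositive V k)}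

/-- `K^k(V)`: the weakly positive elements of `Ω^{k,k}(V)`, `0 ≤ k ≤ n = dim_ℍ V`. -/
def weakCone (k : ℕ) : Set (Omega V k) :=
  {η | ∀ l : ℕ, k + l = Module.finrank ℍ[ℝ]ᵐᵒᵖ V → ∀ ζ ∈ strongCone V l,
    RSpace.mul η ζ ∈ topNonneg V (k + l)}

end Matrices

end QuatForms

end

open QuatForms

/-!
Modulo the elements `[w ⊗ w'] + [w' ⊗ w]` with `w, w'` distinct vectors of a basis, the products of
the squares `[w ⊗ w]` of any two bases of `W` are positive multiples of each other, and a reflection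
`w ↦ -w` shows that an invariant hyperplane contains every product having such a cross factor. An
invariant hyperplane is therefore the kernel of a linear form that is `1` on the product of squares
of one basis and positive on that of every other; the form exists because `[w ⊗ w] ↦ w ∧ wj` maps
the symmetric algebra to the exterior algebra of `W` over `ℂ`.

The cone statements then are dualities. Strongly positive elements are the sums of products of
squares, non-negative matrices the sums of rank-one matrices `ξ ξ^*`. A product of `n - 1` squares
pairs with a matrix `X` as a non-negative multiple of `ξ^* X ξ`, and every `ξ` occurs.
-/

noncomputable section

namespace QuatForms

section LinearAlgebra

open Module

variable {K V ι κ : Type*} [DivisionRing K] [AddCommGroup V] [Module K V]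

theorem exists_basis_eq_update [Finite ι] [DecidableEq ι] (b : Basis ι K V) {i : ι} {v : V}
    (hv : b.repr v i ≠ 0) : ∃ b' : Basis ι K V, ⇑b' = Function.update b i v := by
  have := Fintype.ofFinite ι
  have hb : Set.range b = insert (b i) (b '' {i}ᶜ) := by
    rw [← Set.image_insert_eq, Set.insert_eq, Set.union_compl_self, Set.image_univ]
  have hsubset : insert v (b '' {i}ᶜ) ⊆ Set.range (Function.update b i v) := by
    rintro _ (rfl | ⟨j, hj, rfl⟩)
    · exact ⟨i, Function.update_self ..⟩
    · exact ⟨j, Function.update_of_ne hj ..⟩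
  have hv' : v ∉ Submodule.span K (b '' {i}ᶜ) := fun h =>
    b.mem_span_image.1 h (Finsupp.mem_support_iff.2 hv) rfl
  have hspan : ⊤ ≤ Submodule.span K (Set.range (Function.update b i v)) := by
    refine le_trans ?_ (Submodule.span_mono hsubset)
    rw [← b.span_eq, hb, Submodule.span_le, Set.insert_subset_iff]
    refine ⟨mem_span_insert_exchange ?_ hv', fun x hx => Submodule.subset_span (.inr hx)⟩
    rw [← hb, b.span_eq]
    trivial
  exact ⟨basisOfTopLeSpanOfCardEqFinrank _ hspan (finrank_eq_card_basis b).symm,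
    coe_basisOfTopLeSpanOfCardEqFinrank _ _ _⟩

theorem exists_basis_apply_eq [Finite ι] (b : Basis ι K V) (i : ι) {v : V} (hv : v ≠ 0) :
    ∃ b' : Basis ι K V, b' i = v := by
  classical
  obtain ⟨j, hj⟩ := Finsupp.ne_iff.1 (b.repr.map_ne_zero_iff.2 hv)
  obtain ⟨b', hb'⟩ := exists_basis_eq_update b hj
  exact ⟨b'.reindex (Equiv.swap i j), by simp [hb']⟩

theorem exists_basis_eq_of_linearIndependent [Finite ι] (b : Basis ι K V) {u : ι → V}
    (hu : LinearIndependent K u) : ∃ b' : Basis ι K V, ⇑b' = u := by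
  have := Fintype.ofFinite ι
  have := Module.Finite.of_basis b
  have hspan := hu.span_eq_top_of_card_eq_finrank' (finrank_eq_card_basis b).symm
  exact ⟨Basis.mk hu hspan.ge, Basis.coe_mk ..⟩

theorem exists_repr_ne_zero (b : Basis ι K V) (e : Basis κ K V) (i : ι) :
    ∃ m, b.repr (e m) i ≠ 0 := by
  by_contra! h
  have hcoord : b.coord i = 0 := e.ext h
  simpa using DFunLike.congr_fun hcoord (b i)

theorem exists_notMem_span_range [Fintype ι] {u : ι → V} (hu : LinearIndependent K u)
    (hcard : Fintype.card ι < finrank K V) : ∃ v, v ∉ Submodule.span K (Set.range u) := by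
  by_contra! h
  have htop : Submodule.span K (Set.range u) = ⊤ := eq_top_iff.2 fun v _ => h v
  have := finrank_span_eq_card hu
  rw [htop, finrank_top] at this
  omega

theorem mem_span_image_compl_iff (b : Basis ι K V) {i : ι} {y : V} :
    y ∈ Submodule.span K (b '' {i}ᶜ) ↔ b.repr y i = 0 := by
  rw [b.mem_span_image, Set.subset_compl_singleton_iff, Finset.mem_coe,
    Finsupp.notMem_support_iff]

theorem exists_reflection [Finite ι] (b : Basis ι K V) (i : ι) :
    ∃ g : V ≃ₗ[K] V, g (b i) = -b i ∧ ∀ y ∈ Submodule.span K (b '' {i}ᶜ), g y = y := by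
  classical
  obtain ⟨b', hb'⟩ := exists_basis_eq_update b (i := i) (v := -b i) (by simp)
  have hg (k : ι) : b.equiv b' (Equiv.refl ι) (b k) = Function.update b i (-b i) k := by
    rw [b.equiv_apply, Equiv.refl_apply, hb']
  refine ⟨b.equiv b' (Equiv.refl ι), by rw [hg, Function.update_self], ?_⟩
  refine LinearMap.eqOn_span (f := (b.equiv b' (Equiv.refl ι)).toLinearMap) (g := LinearMap.id) ?_
  rintro _ ⟨k, hk, rfl⟩
  exact (hg k).trans (Function.update_of_ne hk ..)

theorem mem_of_map_eq_neg {K X : Type*} [Field K] [NeZero (2 : K)] [AddCommGroup X] [Module K X]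
    {N : Submodule K X} (hN : finrank K (X ⧸ N) = 1) {g : X →ₗ[K] X} (hg : ∀ x ∈ N, g x ∈ N)
    {p x : X} (hp : p ∉ N) (hgp : g p = p) (hgx : g x = -x) : x ∈ N := by
  have hp' : N.mkQ p ≠ 0 := by simpa using hp
  obtain ⟨a, ha⟩ := (finrank_eq_one_iff_of_nonzero' _ hp').1 hN (N.mkQ x)
  have hsub : a • p - x ∈ N := by
    rwa [← map_smul, ← sub_eq_zero, ← map_sub, Submodule.mkQ_apply,
      Submodule.Quotient.mk_eq_zero] at ha
  have hadd : a • p + x ∈ N := by simpa [hgp, hgx] using hg _ hsub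
  have htwo : (2 : K) • x ∈ N := by
    convert sub_mem hadd hsub using 1
    module
  exact (N.smul_mem_iff two_ne_zero).1 htwo

end LinearAlgebra

/-! ### The squares `[w ⊗ w]` -/

section Squares

variable {W : Type u} [AddCommGroup W] [Module ℝ W] [Module ℍ[ℝ]ᵐᵒᵖ W]

/-- The map `t ↦ [t + σ t]` from `W ⊗_ℝ W` to `(W ⊗_ℍ W̄)^σ`. -/
def symmetrize : W ⊗[ℝ] W →ₗ[ℝ] sigmaFixed W :=
  ((balancedRel W).mkQ ∘ₗ (LinearMap.id + (TensorProduct.comm ℝ W W).toLinearMap)).codRestrict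
    (sigmaFixed W) fun t => by
      change sigma W _ = _
      simp [sigma, add_comm]

/-- The class of `x ⊗ y + y ⊗ x` in `(W ⊗_ℍ W̄)^σ`. -/
def symTensor : W →ₗ[ℝ] W →ₗ[ℝ] sigmaFixed W := (TensorProduct.mk ℝ W W).compr₂ symmetrize

/-- The class of `w ⊗ w` in `(W ⊗_ℍ W̄)^σ`. -/
def sqTensor (w : W) : sigmaFixed W :=
  ⟨(balancedRel W).mkQ (w ⊗ₜ[ℝ] w), by
    change sigma W _ = _
    simp [sigma]⟩

theorem coe_symTensor (x y : W) :
    (symTensor x y : TensorConj W) = (balancedRel W).mkQ (x ⊗ₜ[ℝ] y + y ⊗ₜ[ℝ] x) := rfl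

theorem coe_sqTensor (w : W) :
    (sqTensor w : TensorConj W) = (balancedRel W).mkQ (w ⊗ₜ[ℝ] w) := rfl

theorem symTensor_comm (x y : W) : symTensor x y = symTensor y x :=
  Subtype.ext (by rw [coe_symTensor, coe_symTensor, add_comm])

theorem sqTensor_eq (x : W) : sqTensor x = (2⁻¹ : ℝ) • symTensor x x :=
  Subtype.ext (by
    rw [Submodule.coe_smul, coe_symTensor, coe_sqTensor, map_add, ← two_smul ℝ, smul_smul,
      inv_mul_cancel₀ two_ne_zero, one_smul])

theorem sqTensor_add (x y : W) :
    sqTensor (x + y) = sqTensor x + symTensor x y + sqTensor y := by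
  simp only [sqTensor_eq, map_add, LinearMap.add_apply, symTensor_comm y x]
  module

theorem mkQ_op_smul_tmul (q : ℍ[ℝ]) (x y : W) :
    (balancedRel W).mkQ ((op q • x) ⊗ₜ[ℝ] y) =
      (balancedRel W).mkQ (x ⊗ₜ[ℝ] (op (star q) • y)) := by
  rw [Submodule.mkQ_apply, Submodule.mkQ_apply, Submodule.Quotient.eq]
  exact Submodule.subset_span ⟨x, y, q, rfl⟩

theorem symTensor_op_smul_left (q : ℍ[ℝ]) (x y : W) :
    symTensor (op q • x) y = symTensor x (op (star q) • y) := by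
  have h := mkQ_op_smul_tmul (star q) y x
  rw [star_star] at h
  refine Subtype.ext ?_
  rw [coe_symTensor, coe_symTensor, map_add, map_add, mkQ_op_smul_tmul, h]

theorem op_coe_smul [IsScalarTower ℝ ℍ[ℝ]ᵐᵒᵖ W] (r : ℝ) (x : W) :
    op (r : ℍ[ℝ]) • x = r • x :=
  algebraMap_smul ℍ[ℝ]ᵐᵒᵖ r x

theorem sqTensor_op_smul [IsScalarTower ℝ ℍ[ℝ]ᵐᵒᵖ W] (q : ℍ[ℝ]) (x : W) :
    sqTensor (op q • x) = Quaternion.normSq q • sqTensor x := by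
  rw [sqTensor_eq, symTensor_op_smul_left, ← mul_smul, ← op_mul, Quaternion.self_mul_star,
    op_coe_smul, map_smul, sqTensor_eq, smul_comm]

theorem symmetrize_surjective : Function.Surjective (symmetrize (W := W)) := by
  rintro ⟨t, ht⟩
  obtain ⟨t, rfl⟩ := Submodule.mkQ_surjective _ t
  have hσ : (balancedRel W).mkQ (TensorProduct.comm ℝ W W t) = (balancedRel W).mkQ t := ht
  refine ⟨(2⁻¹ : ℝ) • t, Subtype.ext ?_⟩
  change (balancedRel W).mkQ ((2⁻¹ : ℝ) • t + TensorProduct.comm ℝ W W ((2⁻¹ : ℝ) • t)) = _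
  rw [map_smul, map_add, map_smul, map_smul, hσ]
  module

theorem span_range_sqTensor : Submodule.span ℝ (Set.range (sqTensor : W → sigmaFixed W)) = ⊤ := by
  rw [eq_top_iff, ← LinearMap.range_eq_top.2 symmetrize_surjective, LinearMap.range_eq_map,
    ← TensorProduct.span_tmul_eq_top, Submodule.map_span_le]
  rintro _ ⟨x, y, rfl⟩
  have polarization : symmetrize (x ⊗ₜ y) = sqTensor (x + y) - sqTensor x - sqTensor y := by
    rw [sqTensor_add, add_sub_right_comm, add_sub_cancel_right, add_sub_cancel_left]
    rfl
  rw [polarization]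
  exact sub_mem (sub_mem (Submodule.subset_span ⟨_, rfl⟩) (Submodule.subset_span ⟨_, rfl⟩))
    (Submodule.subset_span ⟨_, rfl⟩)

/-- The element `[w ⊗ w]` of the symmetric algebra. -/
def sqElt (w : W) : SymAlg W := SymmetricAlgebra.ι ℝ (sigmaFixed W) (sqTensor w)

/-- The element `[x ⊗ y + y ⊗ x]` of the symmetric algebra. -/
def symElt : W →ₗ[ℝ] W →ₗ[ℝ] SymAlg W :=
  symTensor.compr₂ (SymmetricAlgebra.ι ℝ (sigmaFixed W))

theorem symElt_comm (x y : W) : symElt x y = symElt y x :=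
  congrArg (SymmetricAlgebra.ι ℝ (sigmaFixed W)) (symTensor_comm x y)

theorem sqElt_eq (x : W) : sqElt x = (2⁻¹ : ℝ) • symElt x x := by
  rw [sqElt, sqTensor_eq, map_smul]
  rfl

theorem symElt_eq_sub (x y : W) : symElt x y = sqElt (x + y) - sqElt x - sqElt y := by
  simp only [sqElt_eq, map_add, LinearMap.add_apply, symElt_comm y x]
  module

theorem sqElt_parallelogram (x y : W) :
    sqElt x = (2⁻¹ : ℝ) • (sqElt (x + y) + sqElt (x - y)) - sqElt y := by
  simp only [sqElt_eq, map_add, map_sub, LinearMap.add_apply, LinearMap.sub_apply, symElt_comm y x]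
  module

theorem sqElt_sub_sqElt (x y : W) :
    sqElt x - sqElt y = (2⁻¹ : ℝ) • symElt (x + y) (x - y) := by
  simp only [sqElt_eq, map_add, map_sub, LinearMap.add_apply, symElt_comm y x]
  module

theorem sqElt_neg (x : W) : sqElt (-x) = sqElt x := by
  simp only [sqElt_eq, map_neg, LinearMap.neg_apply, neg_neg]

theorem sqElt_op_smul [IsScalarTower ℝ ℍ[ℝ]ᵐᵒᵖ W] (q : ℍ[ℝ]) (x : W) :
    sqElt (op q • x) = Quaternion.normSq q • sqElt x := by
  rw [sqElt, sqTensor_op_smul, map_smul, sqElt]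

theorem range_ι_eq_span_sqElt : LinearMap.range (SymmetricAlgebra.ι ℝ (sigmaFixed W)) =
    Submodule.span ℝ (Set.range (sqElt (W := W))) := by
  rw [LinearMap.range_eq_map, ← span_range_sqTensor, Submodule.map_span, ← Set.range_comp]
  rfl

theorem symPow_eq_span (k : ℕ) :
    symPow W k = Submodule.span ℝ (Set.range fun w : Fin k → W => ∏ i, sqElt (w i)) := by
  rw [symPow, range_ι_eq_span_sqElt, Submodule.span_pow]
  congr 1
  ext x
  rw [Set.mem_pow]
  constructor
  · rintro ⟨f, rfl⟩
    choose w hw using fun i => (f i).2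
    exact ⟨w, by simp only [hw, List.prod_ofFn]⟩
  · rintro ⟨w, rfl⟩
    exact ⟨fun i => ⟨sqElt (w i), w i, rfl⟩, by simp [List.prod_ofFn]⟩

theorem prod_sqElt_mem {k : ℕ} (w : Fin k → W) : ∏ i, sqElt (w i) ∈ symPow W k := by
  rw [symPow_eq_span]
  exact Submodule.subset_span ⟨w, rfl⟩

theorem sqElt_mul_prod_mem_span {k : ℕ} (hk : k < Module.finrank ℍ[ℝ]ᵐᵒᵖ W) {u : Fin k → W}
    (hu : LinearIndependent ℍ[ℝ]ᵐᵒᵖ u) (x : W) :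
    sqElt x * ∏ i, sqElt (u i) ∈ Submodule.span ℝ
      {x | ∃ u : Fin (k + 1) → W, LinearIndependent ℍ[ℝ]ᵐᵒᵖ u ∧ x = ∏ i, sqElt (u i)} := by
  have mem_of_notMem {v : W} (hv : v ∉ Submodule.span ℍ[ℝ]ᵐᵒᵖ (Set.range u)) :
      sqElt v * ∏ i, sqElt (u i) ∈ Submodule.span ℝ
        {x | ∃ u : Fin (k + 1) → W, LinearIndependent ℍ[ℝ]ᵐᵒᵖ u ∧ x = ∏ i, sqElt (u i)} :=
    Submodule.subset_span ⟨Fin.cons v u, hu.finCons hv, by simp [Fin.prod_univ_succ]⟩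
  by_cases hx : x ∈ Submodule.span ℍ[ℝ]ᵐᵒᵖ (Set.range u)
  · obtain ⟨v, hv⟩ := exists_notMem_span_range hu (by rwa [Fintype.card_fin])
    rw [sqElt_parallelogram x v, sub_mul, smul_mul_assoc, add_mul]
    refine sub_mem (Submodule.smul_mem _ _ (add_mem (mem_of_notMem ?_) (mem_of_notMem ?_)))
      (mem_of_notMem hv)
    · rwa [add_mem_cancel_left hx]
    · rwa [Submodule.sub_mem_iff_right _ hx]
  · exact mem_of_notMem hx

theorem prod_sqElt_mem_span {k : ℕ} (hk : k ≤ Module.finrank ℍ[ℝ]ᵐᵒᵖ W) (w : Fin k → W) :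
    ∏ i, sqElt (w i) ∈ Submodule.span ℝ
      {x | ∃ u : Fin k → W, LinearIndependent ℍ[ℝ]ᵐᵒᵖ u ∧ x = ∏ i, sqElt (u i)} := by
  induction k with
  | zero => exact Submodule.subset_span ⟨w, linearIndependent_empty_type, rfl⟩
  | succ k ih =>
    rw [Fin.prod_univ_succ]
    have hprod := ih (Nat.le_of_succ_le hk) fun i => w i.succ
    generalize ∏ i : Fin k, sqElt (w i.succ) = y at hprod ⊢
    induction hprod using Submodule.span_induction with
    | mem x hx =>
      obtain ⟨u, hu, rfl⟩ := hx
      exact sqElt_mul_prod_mem_span hk hu (w 0)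
    | zero => simp only [mul_zero, zero_mem]
    | add x y _ _ hx hy => simpa only [mul_add] using add_mem hx hy
    | smul c x _ hx => simpa only [mul_smul_comm] using Submodule.smul_mem _ c hx

theorem symPow_eq_span_linearIndependent {k : ℕ} (hk : k ≤ Module.finrank ℍ[ℝ]ᵐᵒᵖ W) :
    symPow W k = Submodule.span ℝ
      {x | ∃ u : Fin k → W, LinearIndependent ℍ[ℝ]ᵐᵒᵖ u ∧ x = ∏ i, sqElt (u i)} := by
  refine le_antisymm ?_ (Submodule.span_le.2 ?_)
  · rw [symPow_eq_span, Submodule.span_le]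
    rintro _ ⟨w, rfl⟩
    exact prod_sqElt_mem_span hk w
  · rintro _ ⟨u, -, rfl⟩
    exact prod_sqElt_mem u

end Squares

section Functoriality

variable {W₁ : Type u} [AddCommGroup W₁] [Module ℝ W₁] [Module ℍ[ℝ]ᵐᵒᵖ W₁]
  [IsScalarTower ℝ ℍ[ℝ]ᵐᵒᵖ W₁]
  {W₂ : Type v} [AddCommGroup W₂] [Module ℝ W₂] [Module ℍ[ℝ]ᵐᵒᵖ W₂]
  [IsScalarTower ℝ ℍ[ℝ]ᵐᵒᵖ W₂]

theorem symAlgMap_sqElt (f : W₁ →ₗ[ℍ[ℝ]ᵐᵒᵖ] W₂) (w : W₁) :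
    symAlgMap f (sqElt w) = sqElt (f w) :=
  SymmetricAlgebra.lift_ι_apply ..

theorem symAlgMap_symElt (f : W₁ →ₗ[ℍ[ℝ]ᵐᵒᵖ] W₂) (x y : W₁) :
    symAlgMap f (symElt x y) = symElt (f x) (f y) := by
  simp only [symElt_eq_sub, map_sub, symAlgMap_sqElt, map_add]

theorem symAlgMap_prod_sqElt {ι : Type*} (f : W₁ →ₗ[ℍ[ℝ]ᵐᵒᵖ] W₂) (s : Finset ι) (w : ι → W₁) :
    symAlgMap f (∏ i ∈ s, sqElt (w i)) = ∏ i ∈ s, sqElt (f (w i)) := by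
  simp only [map_prod, symAlgMap_sqElt]

end Functoriality

/-! ### Exchanging bases modulo cross elements -/

section Exchange

variable {W : Type u} [AddCommGroup W] [Module ℝ W] [Module ℍ[ℝ]ᵐᵒᵖ W]

variable (W) in
/-- The span of the cross elements `[x ⊗ y + y ⊗ x] ∏_{k ≠ i} [b_k ⊗ b_k]`, where `b` is a basis and
`y` has no `b_i`-component. It is the kernel of the Moore map when `n = dim_ℍ W`. -/
def crossSpan (n : ℕ) : Submodule ℝ (SymAlg W) :=
  Submodule.span ℝ {t | ∃ (b : Module.Basis (Fin n) ℍ[ℝ]ᵐᵒᵖ W) (i : Fin n) (x y : W),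
    b.repr y i = 0 ∧ t = symElt x y * ∏ k ∈ Finset.univ.erase i, sqElt (b k)}

theorem prod_sqElt_update {n : ℕ} (w : Fin n → W) (i : Fin n) (v : W) :
    ∏ k, sqElt (Function.update w i v k) = sqElt v * ∏ k ∈ Finset.univ.erase i, sqElt (w k) := by
  rw [← Finset.mul_prod_erase _ _ (Finset.mem_univ i), Function.update_self]
  congr 1
  exact Finset.prod_congr rfl fun k hk => by
    rw [Function.update_of_ne (Finset.ne_of_mem_erase hk)]

theorem symElt_mul_prod_erase_mem {n : ℕ} (w : Fin n → W) (i : Fin n) (x y : W) :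
    symElt x y * ∏ k ∈ Finset.univ.erase i, sqElt (w k) ∈ symPow W n := by
  rw [symElt_eq_sub, sub_mul, sub_mul, ← prod_sqElt_update, ← prod_sqElt_update,
    ← prod_sqElt_update]
  exact sub_mem (sub_mem (prod_sqElt_mem _) (prod_sqElt_mem _)) (prod_sqElt_mem _)

variable [IsScalarTower ℝ ℍ[ℝ]ᵐᵒᵖ W] {n : ℕ}

theorem prod_sqElt_update_sub_mem (b : Module.Basis (Fin n) ℍ[ℝ]ᵐᵒᵖ W) (i : Fin n) (v : W) :
    ∏ k, sqElt (Function.update b i v k) -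
      Quaternion.normSq (unop (b.repr v i)) • ∏ k, sqElt (b k) ∈ crossSpan W n := by
  rw [prod_sqElt_update, ← Finset.mul_prod_erase _ _ (Finset.mem_univ i), ← smul_mul_assoc,
    ← sqElt_op_smul, op_unop, ← sub_mul, sqElt_sub_sqElt, smul_mul_assoc]
  exact Submodule.smul_mem _ _ (Submodule.subset_span ⟨b, i, _, _, by simp, rfl⟩)

theorem exists_basis_range_exchange (e b : Module.Basis (Fin n) ℍ[ℝ]ᵐᵒᵖ W) (S : Finset (Fin n)) :
    ∃ (r : ℝ) (b' : Module.Basis (Fin n) ℍ[ℝ]ᵐᵒᵖ W), 0 < r ∧ (∀ i ∈ S, b' i ∈ Set.range e) ∧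
      ∏ k, sqElt (b k) - r • ∏ k, sqElt (b' k) ∈ crossSpan W n := by
  induction S using Finset.induction_on with
  | empty => exact ⟨1, b, one_pos, by simp, by simp⟩
  | insert i S _ ih =>
    obtain ⟨r, b', hr, hS, hb'⟩ := ih
    obtain ⟨m, hm⟩ := exists_repr_ne_zero b' e i
    obtain ⟨b'', hb''⟩ := exists_basis_eq_update b' hm
    set c := Quaternion.normSq (unop (b'.repr (e m) i)) with hc
    have hpos : 0 < c := Quaternion.normSq_nonneg.lt_of_ne'
      (Quaternion.normSq_ne_zero.2 ((unop_ne_zero_iff _).2 hm))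
    refine ⟨r * c⁻¹, b'', by positivity, ?_, ?_⟩
    · rw [hb'', Finset.forall_mem_insert, Function.update_self]
      refine ⟨⟨m, rfl⟩, fun k hk => ?_⟩
      rcases eq_or_ne k i with rfl | hki
      · rw [Function.update_self]
        exact ⟨m, rfl⟩
      · rw [Function.update_of_ne hki]
        exact hS k hk
    · have hstep : ∏ k, sqElt (b'' k) - c • ∏ k, sqElt (b' k) ∈ crossSpan W n := by
        rw [hb'']
        exact prod_sqElt_update_sub_mem b' i (e m)
      have hsplit : ∏ k, sqElt (b k) - (r * c⁻¹) • ∏ k, sqElt (b'' k) =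
          ∏ k, sqElt (b k) - r • ∏ k, sqElt (b' k) -
            (r * c⁻¹) • (∏ k, sqElt (b'' k) - c • ∏ k, sqElt (b' k)) := by
        rw [smul_sub, smul_smul, inv_mul_cancel_right₀ hpos.ne']
        abel
      rw [hsplit]
      exact sub_mem hb' (Submodule.smul_mem _ _ hstep)

theorem exists_pos_prod_sqElt_sub_mem (e b : Module.Basis (Fin n) ℍ[ℝ]ᵐᵒᵖ W) :
    ∃ r : ℝ, 0 < r ∧ ∏ k, sqElt (b k) - r • ∏ k, sqElt (e k) ∈ crossSpan W n := by
  obtain ⟨r, b', hr, hrange, hmem⟩ := exists_basis_range_exchange e b Finset.univ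
  choose f hf using fun i => hrange i (Finset.mem_univ i)
  have hinj : Function.Injective f := fun i j hij => b'.injective (by rw [← hf, ← hf, hij])
  have hprod : ∏ k, sqElt (b' k) = ∏ k, sqElt (e k) := by
    simp only [← hf]
    exact (Finite.injective_iff_bijective.1 hinj).prod_comp fun k => sqElt (e k)
  exact ⟨r, hr, hprod ▸ hmem⟩

theorem symPow_le_span_sup_crossSpan (e : Module.Basis (Fin n) ℍ[ℝ]ᵐᵒᵖ W) :
    symPow W n ≤ Submodule.span ℝ {∏ k, sqElt (e k)} ⊔ crossSpan W n := by
  have hn : Module.finrank ℍ[ℝ]ᵐᵒᵖ W = n := by simp [Module.finrank_eq_card_basis e]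
  rw [symPow_eq_span_linearIndependent hn.ge, Submodule.span_le]
  rintro _ ⟨u, hu, rfl⟩
  obtain ⟨b, rfl⟩ := exists_basis_eq_of_linearIndependent e hu
  obtain ⟨r, -, hr⟩ := exists_pos_prod_sqElt_sub_mem e b
  refine (Submodule.sub_mem_iff_left _ (Submodule.mem_sup_left (Submodule.smul_mem _ r
    (Submodule.mem_span_singleton_self _)))).1 (Submodule.mem_sup_right hr)

end Exchange

/-! ### The Moore map through a complex exterior algebra -/

/-- A linear functional on the symmetric algebra that vanishes on the ideal generated by the
elements `[x ⊗ x] [x q ⊗ y + y ⊗ x q]` and takes the value `1` at `∏ [e_i ⊗ e_i]`: in degree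
`n = dim_ℍ W` it is the Moore map. -/
structure IsTopForm {W : Type u} [AddCommGroup W] [Module ℝ W] [Module ℍ[ℝ]ᵐᵒᵖ W] {n : ℕ}
    (e : Module.Basis (Fin n) ℍ[ℝ]ᵐᵒᵖ W)
    (f : SymAlg W →ₗ[ℝ] ℝ) : Prop where
  cross : ∀ (x y : W) (q : ℍ[ℝ]ᵐᵒᵖ) (z : SymAlg W), f (sqElt x * symElt (q • x) y * z) = 0
  prod_basis : f (∏ i, sqElt (e i)) = 1

section Exterior

open CliffordAlgebra (contractLeft contractLeft_ι_mul contractLeft_one)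
open scoped IsMulCommutative

section Bivectors

variable {R M : Type*} [CommRing R] [AddCommGroup M] [Module R M]

theorem ι_mul_ι_eq_neg (a b : M) : ExteriorAlgebra.ι R a * ExteriorAlgebra.ι R b =
    -(ExteriorAlgebra.ι R b * ExteriorAlgebra.ι R a) :=
  eq_neg_of_add_eq_zero_left (ExteriorAlgebra.ι_add_mul_swap a b)

theorem commute_ι_mul_ι (a b c : M) :
    Commute (ExteriorAlgebra.ι R a * ExteriorAlgebra.ι R b) (ExteriorAlgebra.ι R c) := by
  rw [Commute, SemiconjBy, mul_assoc, ι_mul_ι_eq_neg b c, mul_neg, ← mul_assoc,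
    ι_mul_ι_eq_neg a c, neg_mul, neg_neg, mul_assoc]

theorem ι_mul_ι_mul_ι_eq_zero (a b : M) :
    ExteriorAlgebra.ι R a * ExteriorAlgebra.ι R b * ExteriorAlgebra.ι R a = 0 := by
  rw [(commute_ι_mul_ι (R := R) a b a).eq, ← mul_assoc, ExteriorAlgebra.ι_sq_zero, zero_mul]

theorem contractLeft_ι_mul_ι_mul_eq_zero {d : Module.Dual R M} {a b : M} {x : ExteriorAlgebra R M}
    (ha : d a = 0) (hb : d b = 0) (hx : contractLeft (Q := 0) d x = 0) :
    contractLeft (Q := 0) d (ExteriorAlgebra.ι R a * (ExteriorAlgebra.ι R b * x)) = 0 := by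
  rw [ExteriorAlgebra.ι, contractLeft_ι_mul, contractLeft_ι_mul, ha, hb, hx]
  simp only [zero_smul, mul_zero, sub_zero]

theorem eq_zero_of_ι_mul_ι_mul_eq_zero {d d' : Module.Dual R M} {a b : M}
    {x : ExteriorAlgebra R M} (ha : d a = 1) (hb : d b = 0) (hb' : d' b = 1)
    (hx : contractLeft (Q := 0) d x = 0) (hx' : contractLeft (Q := 0) d' x = 0)
    (h : ExteriorAlgebra.ι R a * (ExteriorAlgebra.ι R b * x) = 0) : x = 0 := by
  have hd : contractLeft (Q := 0) d (ExteriorAlgebra.ι R a * (ExteriorAlgebra.ι R b * x)) =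
      ExteriorAlgebra.ι R b * x := by
    rw [ExteriorAlgebra.ι, contractLeft_ι_mul, contractLeft_ι_mul, ha, hb, hx]
    simp only [one_smul, zero_smul, mul_zero, sub_zero]
  rw [h, map_zero, eq_comm] at hd
  have hd' : contractLeft (Q := 0) d' (ExteriorAlgebra.ι R b * x) = x := by
    rw [ExteriorAlgebra.ι, contractLeft_ι_mul, hb', hx', one_smul, mul_zero, sub_zero]
  rw [← hd', hd, map_zero]

variable (M) in
/-- The commutative real subalgebra of the complex exterior algebra that is generated by the
products of two vectors. -/
def bivectorAlg [Module ℂ M] : Subalgebra ℝ (ExteriorAlgebra ℂ M) :=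
  Algebra.adjoin ℝ {x | ∃ a b : M, x = ExteriorAlgebra.ι ℂ a * ExteriorAlgebra.ι ℂ b}

instance [Module ℂ M] : IsMulCommutative (bivectorAlg M) :=
  Algebra.isMulCommutative_adjoin ℝ (by
    rintro _ ⟨a, b, rfl⟩ _ ⟨c, d, rfl⟩
    exact (commute_ι_mul_ι a b c).mul_right (commute_ι_mul_ι a b d))

end Bivectors

/-- The complex number `z` in `q = z + j z'`. -/
@[simps]
def firstCoord (q : ℍ[ℝ]) : ℂ := ⟨q.re, q.imI⟩

/-- The complex number `z'` in `q = z + j z'`. -/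
@[simps]
def secondCoord (q : ℍ[ℝ]) : ℂ := ⟨q.imJ, -q.imK⟩

/-- The quaternion unit `j`. -/
@[simps]
def quatJ : ℍ[ℝ] := ⟨0, 0, 1, 0⟩

theorem eq_firstCoord_add_quatJ_mul_secondCoord (q : ℍ[ℝ]) :
    q = (firstCoord q : ℍ[ℝ]) + quatJ * (secondCoord q : ℍ[ℝ]) := by
  ext <;> simp [Quaternion.re_mul, Quaternion.imI_mul, Quaternion.imJ_mul, Quaternion.imK_mul]

theorem mul_quatJ (q : ℍ[ℝ]) :
    q * quatJ = quatJ * (star (firstCoord q) : ℂ) - (star (secondCoord q) : ℂ) := by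
  ext <;> simp [Quaternion.re_mul, Quaternion.imI_mul, Quaternion.imJ_mul, Quaternion.imK_mul]

theorem firstCoord_star (q : ℍ[ℝ]) : firstCoord (star q) = star (firstCoord q) := by
  apply Complex.ext <;> simp

theorem secondCoord_star (q : ℍ[ℝ]) : secondCoord (star q) = -secondCoord q := by
  apply Complex.ext <;> simp

theorem firstCoord_add (p q : ℍ[ℝ]) : firstCoord (p + q) = firstCoord p + firstCoord q := by
  apply Complex.ext <;> simp

theorem secondCoord_add (p q : ℍ[ℝ]) : secondCoord (p + q) = secondCoord p + secondCoord q := by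
  apply Complex.ext <;> simp [add_comm]

theorem firstCoord_mul_coe (q : ℍ[ℝ]) (z : ℂ) : firstCoord (q * z) = firstCoord q * z := by
  apply Complex.ext <;> simp [Quaternion.re_mul, Quaternion.imI_mul]

theorem secondCoord_mul_coe (q : ℍ[ℝ]) (z : ℂ) : secondCoord (q * z) = secondCoord q * z := by
  apply Complex.ext
  · simp [Quaternion.imJ_mul]
  · simp only [secondCoord_im, Quaternion.imK_mul, Quaternion.imK_coeComplex, mul_zero,
      Quaternion.imJ_coeComplex, add_zero, Quaternion.imI_coeComplex, zero_sub,
      Quaternion.re_coeComplex, neg_add_rev, neg_neg, Complex.mul_im, secondCoord_re, neg_mul]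
    ring

variable {W : Type u} [AddCommGroup W] [Module ℍ[ℝ]ᵐᵒᵖ W]

/-- `W` as a complex vector space, by restriction of the scalars to `ℂ ⊂ ℍ`. -/
abbrev complexModule (W : Type u) [AddCommGroup W] [Module ℍ[ℝ]ᵐᵒᵖ W] : Module ℂ W :=
  Module.compHom W ((Quaternion.ofComplex : ℂ →+* ℍ[ℝ]).toOpposite fun z w =>
    (Commute.all z w).map (Quaternion.ofComplex : ℂ →+* ℍ[ℝ]))

attribute [local instance] complexModule

theorem complex_smul_eq (z : ℂ) (w : W) : z • w = op (z : ℍ[ℝ]) • w := rfl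

variable [Module ℝ W] [IsScalarTower ℝ ℍ[ℝ]ᵐᵒᵖ W]

instance : IsScalarTower ℝ ℂ W where
  smul_assoc r z w := by
    rw [complex_smul_eq, complex_smul_eq, ← smul_assoc, ← op_smul]
    simp

/-- The map `w ↦ w · j`. -/
def smulJ : W →ₗ[ℝ] W := DistribSMul.toLinearMap ℝ W (op quatJ)

theorem op_smul_eq (q : ℍ[ℝ]) (w : W) :
    op q • w = firstCoord q • w + secondCoord q • smulJ w := by
  conv_lhs => rw [eq_firstCoord_add_quatJ_mul_secondCoord q, op_add, add_smul, op_mul, mul_smul]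
  rfl

theorem smulJ_op_smul (q : ℍ[ℝ]) (w : W) :
    smulJ (op q • w) = star (firstCoord q) • smulJ w - star (secondCoord q) • w := by
  change op quatJ • op q • w = _
  rw [smul_smul, ← op_mul, mul_quatJ, op_sub, sub_smul, op_mul, mul_smul]
  rfl

/-- The bivector `x ∧ y j + y ∧ x j`. -/
def bivector : W →ₗ[ℝ] W →ₗ[ℝ] ExteriorAlgebra ℂ W :=
  let wedgeJ := (LinearMap.mul ℝ (ExteriorAlgebra ℂ W)).compl₁₂
    ((ExteriorAlgebra.ι ℂ).restrictScalars ℝ) ((ExteriorAlgebra.ι ℂ).restrictScalars ℝ ∘ₗ smulJ)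
  wedgeJ + wedgeJ.flip

theorem bivector_apply (x y : W) :
    bivector x y = ExteriorAlgebra.ι ℂ x * ExteriorAlgebra.ι ℂ (smulJ y) +
      ExteriorAlgebra.ι ℂ y * ExteriorAlgebra.ι ℂ (smulJ x) := rfl

theorem bivector_comm (x y : W) : bivector x y = bivector y x := by
  rw [bivector_apply, bivector_apply, add_comm]

theorem bivector_mem (x y : W) : bivector x y ∈ bivectorAlg W := by
  rw [bivector_apply]
  exact add_mem (Algebra.subset_adjoin ⟨_, _, rfl⟩) (Algebra.subset_adjoin ⟨_, _, rfl⟩)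

theorem bivector_op_smul_left (q : ℍ[ℝ]) (x y : W) :
    bivector (op q • x) y = bivector x (op (star q) • y) := by
  rw [bivector_apply, bivector_apply, smulJ_op_smul, smulJ_op_smul, op_smul_eq, op_smul_eq]
  simp only [firstCoord_star, secondCoord_star, star_neg, star_star, neg_smul, map_add, map_sub,
    map_neg, map_smul, add_mul, mul_sub, mul_neg, neg_mul, smul_mul_assoc, mul_smul_comm]
  rw [ι_mul_ι_eq_neg y x, ι_mul_ι_eq_neg (smulJ x) (smulJ y)]
  module

/-- The map `x ⊗ y ↦ x ∧ y j + y ∧ x j` on `W ⊗_ℍ W̄`. -/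
def tensorBivector : TensorConj W →ₗ[ℝ] ExteriorAlgebra ℂ W :=
  (balancedRel W).liftQ (TensorProduct.lift bivector) (by
    refine Submodule.span_le.2 ?_
    rintro _ ⟨x, y, q, rfl⟩
    simp [bivector_op_smul_left])

theorem tensorBivector_mkQ_tmul (x y : W) :
    tensorBivector ((balancedRel W).mkQ (x ⊗ₜ[ℝ] y)) = bivector x y := rfl

theorem tensorBivector_mem (t : TensorConj W) : tensorBivector t ∈ bivectorAlg W := by
  obtain ⟨t, rfl⟩ := Submodule.mkQ_surjective _ t
  induction t using TensorProduct.induction_on with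
  | zero => simp only [map_zero, zero_mem]
  | tmul x y =>
    exact bivector_mem x y
  | add a b ha hb => simpa only [map_add] using add_mem ha hb

/-- The homomorphism from the symmetric algebra to the even exterior algebra with
`[w ⊗ w] ↦ 2 w ∧ w j`. -/
def spinHom : SymAlg W →ₐ[ℝ] ExteriorAlgebra ℂ W :=
  (bivectorAlg W).val.comp (SymmetricAlgebra.lift
    ((tensorBivector ∘ₗ (sigmaFixed W).subtype).codRestrict
      (Subalgebra.toSubmodule (bivectorAlg W)) fun t => tensorBivector_mem t.1))

theorem spinHom_ι (t : sigmaFixed W) :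
    spinHom (SymmetricAlgebra.ι ℝ (sigmaFixed W) t) = tensorBivector t := by
  rw [spinHom, AlgHom.comp_apply, SymmetricAlgebra.lift_ι_apply]
  rfl

theorem spinHom_sqElt (x : W) : spinHom (sqElt x) =
    (2 : ℂ) • (ExteriorAlgebra.ι ℂ x * ExteriorAlgebra.ι ℂ (smulJ x)) := by
  rw [sqElt, spinHom_ι, coe_sqTensor, tensorBivector_mkQ_tmul, bivector_apply, two_smul]

theorem spinHom_symElt (x y : W) : spinHom (symElt x y) = (2 : ℂ) • bivector x y := by
  rw [symElt, LinearMap.compr₂_apply, spinHom_ι, coe_symTensor, map_add, map_add,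
    tensorBivector_mkQ_tmul, tensorBivector_mkQ_tmul, bivector_comm y x, two_smul]

theorem spinHom_sqElt_mul_symElt (x y : W) (q : ℍ[ℝ]ᵐᵒᵖ) :
    spinHom (sqElt x * symElt (q • x) y) = 0 := by
  have hx : ExteriorAlgebra.ι ℂ x * ExteriorAlgebra.ι ℂ (smulJ x) *
      ExteriorAlgebra.ι ℂ (smulJ x) = 0 := by
    rw [mul_assoc, ExteriorAlgebra.ι_sq_zero, mul_zero]
  rw [map_mul, spinHom_sqElt, spinHom_symElt, ← op_unop q, bivector_apply,
    ι_mul_ι_eq_neg y, smulJ_op_smul, op_smul_eq]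
  simp only [map_add, map_sub, map_smul, add_mul, sub_mul, mul_add, mul_neg, mul_sub,
    smul_mul_assoc, mul_smul_comm, ← mul_assoc, hx, ι_mul_ι_mul_ι_eq_zero x (smulJ x),
    zero_mul, smul_zero, add_zero, neg_zero, sub_zero]

variable {n : ℕ}

/-- The complex coordinate `z_i` in `w = ∑ e_i · (z_i + j z'_i)`. -/
def firstDual (e : Module.Basis (Fin n) ℍ[ℝ]ᵐᵒᵖ W) (i : Fin n) : Module.Dual ℂ W where
  toFun w := firstCoord (unop (e.repr w i))
  map_add' x y := by simp [firstCoord_add]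
  map_smul' z x := by simp [complex_smul_eq, firstCoord_mul_coe, mul_comm]

/-- The complex coordinate `z'_i` in `w = ∑ e_i · (z_i + j z'_i)`. -/
def secondDual (e : Module.Basis (Fin n) ℍ[ℝ]ᵐᵒᵖ W) (i : Fin n) : Module.Dual ℂ W where
  toFun w := secondCoord (unop (e.repr w i))
  map_add' x y := by simp [secondCoord_add]
  map_smul' z x := by simp [complex_smul_eq, secondCoord_mul_coe, mul_comm]

theorem contractLeft_spinHom_prod_eq_zero (w : Fin n → W) (S : Finset (Fin n))
    (d : Module.Dual ℂ W) (hd : ∀ i ∈ S, d (w i) = 0 ∧ d (smulJ (w i)) = 0) :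
    contractLeft (Q := 0) d (spinHom (∏ i ∈ S, sqElt (w i))) = 0 := by
  induction S using Finset.induction_on with
  | empty =>
    rw [Finset.prod_empty, map_one]
    exact contractLeft_one 0 d
  | insert i S hi ih =>
    rw [Finset.forall_mem_insert] at hd
    rw [Finset.prod_insert hi, map_mul, spinHom_sqElt, smul_mul_assoc, map_smul, mul_assoc,
      contractLeft_ι_mul_ι_mul_eq_zero hd.1.1 hd.1.2 (ih hd.2), smul_zero]

theorem spinHom_prod_ne_zero (e : Module.Basis (Fin n) ℍ[ℝ]ᵐᵒᵖ W) (S : Finset (Fin n)) :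
    spinHom (∏ i ∈ S, sqElt (e i)) ≠ 0 := by
  induction S using Finset.induction_on with
  | empty => simp
  | insert i S hi ih =>
    have hij : ∀ j ∈ S, j ≠ i := fun j hj => ne_of_mem_of_not_mem hj hi
    rw [Finset.prod_insert hi, map_mul, spinHom_sqElt, smul_mul_assoc, mul_assoc]
    refine fun h => ih (eq_zero_of_ι_mul_ι_mul_eq_zero (d := firstDual e i) (d' := secondDual e i)
      ?_ ?_ ?_ ?_ ?_ ((smul_eq_zero.1 h).resolve_left two_ne_zero))
    · simp [firstDual, Complex.ext_iff]
    · simp [firstDual, smulJ, Complex.ext_iff]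
    · simp [secondDual, smulJ, Complex.ext_iff]
    · refine contractLeft_spinHom_prod_eq_zero _ S _ fun j hj => ?_
      simp [firstDual, smulJ, hij j hj, Complex.ext_iff]
    · refine contractLeft_spinHom_prod_eq_zero _ S _ fun j hj => ?_
      simp [secondDual, smulJ, hij j hj, Complex.ext_iff]

theorem exists_isTopForm (e : Module.Basis (Fin n) ℍ[ℝ]ᵐᵒᵖ W) : ∃ f, IsTopForm e f := by
  obtain ⟨g, hg⟩ := not_forall.1 (mt (Module.forall_dual_apply_eq_zero_iff ℝ _).1
    (spinHom_prod_ne_zero e Finset.univ))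
  refine ⟨(g (spinHom (∏ i, sqElt (e i))))⁻¹ • (g ∘ₗ spinHom.toLinearMap), fun x y q z => ?_, ?_⟩
  · rw [LinearMap.smul_apply, LinearMap.comp_apply, AlgHom.toLinearMap_apply, map_mul,
      spinHom_sqElt_mul_symElt, zero_mul, map_zero, smul_zero]
  · exact inv_mul_cancel₀ hg

end Exterior

/-! ### Invariant hyperplanes -/

section TopForm

variable {W : Type u} [AddCommGroup W] [Module ℝ W] [Module ℍ[ℝ]ᵐᵒᵖ W] {n : ℕ}
  {e : Module.Basis (Fin n) ℍ[ℝ]ᵐᵒᵖ W} {f : SymAlg W →ₗ[ℝ] ℝ}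

namespace IsTopForm

theorem symElt_mul_prod_eq_zero (hf : IsTopForm e f) {ι : Type*} {S : Finset ι} {w : ι → W} {v : W}
    (hv : v ∈ Submodule.span ℍ[ℝ]ᵐᵒᵖ (w '' S)) (x : W) (z : SymAlg W) :
    f (symElt x v * (∏ k ∈ S, sqElt (w k)) * z) = 0 := by
  classical
  obtain ⟨c, rfl⟩ := (Submodule.mem_span_image_finset_iff_exists_fun _).1 hv
  simp only [map_sum, Finset.sum_mul]
  refine Finset.sum_eq_zero fun j _ => ?_
  rw [← Finset.mul_prod_erase S (fun k => sqElt (w k)) j.2, symElt_comm, mul_left_comm, mul_assoc,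
    mul_assoc, ← mul_assoc]
  exact hf.cross ..

theorem prod_eq_zero (hf : IsTopForm e f) {ι : Type*} [Fintype ι] {w : ι → W}
    (hw : ¬LinearIndependent ℍ[ℝ]ᵐᵒᵖ w) (z : SymAlg W) : f ((∏ i, sqElt (w i)) * z) = 0 := by
  classical
  obtain ⟨i, hi⟩ := not_forall.1 (mt linearIndependent_iff_notMem_span.2 hw)
  have hmem : w i ∈ Submodule.span ℍ[ℝ]ᵐᵒᵖ (w '' (Finset.univ.erase i : Finset ι)) := by
    simpa [Set.compl_eq_univ_sdiff] using hi
  rw [← Finset.mul_prod_erase _ _ (Finset.mem_univ i), sqElt_eq, smul_mul_assoc, smul_mul_assoc,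
    map_smul, hf.symElt_mul_prod_eq_zero hmem, smul_zero]

theorem crossSpan_eq_zero (hf : IsTopForm e f) {x : SymAlg W} (hx : x ∈ crossSpan W n) :
    f x = 0 := by
  suffices h : crossSpan W n ≤ LinearMap.ker f from h hx
  refine Submodule.span_le.2 ?_
  rintro _ ⟨b, i, x, y, hy, rfl⟩
  rw [← mem_span_image_compl_iff] at hy
  simpa using hf.symElt_mul_prod_eq_zero (S := Finset.univ.erase i) (v := y)
    (by simpa [Set.compl_eq_univ_sdiff] using hy) x 1

theorem surjective (hf : IsTopForm e f) : Function.Surjective (f ∘ₗ (symPow W n).subtype) :=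
  fun r => ⟨r • ⟨_, prod_sqElt_mem e⟩, by
    rw [map_smul, LinearMap.comp_apply, Submodule.subtype_apply, hf.prod_basis, smul_eq_mul,
      mul_one]⟩

variable [IsScalarTower ℝ ℍ[ℝ]ᵐᵒᵖ W]

theorem symAlgMap_crossSpan_eq_zero (hf : IsTopForm e f)
    {W' : Type v} [AddCommGroup W'] [Module ℝ W'] [Module ℍ[ℝ]ᵐᵒᵖ W']
    [IsScalarTower ℝ ℍ[ℝ]ᵐᵒᵖ W'] (g : W' →ₗ[ℍ[ℝ]ᵐᵒᵖ] W) {k : ℕ} {x : SymAlg W'}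
    (hx : x ∈ crossSpan W' k) (z : SymAlg W) : f (symAlgMap g x * z) = 0 := by
  suffices h : crossSpan W' k ≤ LinearMap.ker
      (f ∘ₗ LinearMap.mulRight ℝ z ∘ₗ (symAlgMap g).toLinearMap) from h hx
  refine Submodule.span_le.2 ?_
  rintro _ ⟨b, i, x, y, hy, rfl⟩
  have hgy : g y ∈ Submodule.span ℍ[ℝ]ᵐᵒᵖ
      ((fun k => g (b k)) '' (Finset.univ.erase i : Finset (Fin k))) := by
    rw [← mem_span_image_compl_iff] at hy
    have h := Submodule.mem_map_of_mem (f := g) hy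
    rw [Submodule.map_span, Set.image_image] at h
    simpa [Set.compl_eq_univ_sdiff] using h
  change f (symAlgMap g _ * z) = 0
  rw [map_mul (symAlgMap g), symAlgMap_symElt, symAlgMap_prod_sqElt]
  exact hf.symElt_mul_prod_eq_zero hgy _ z

theorem prod_pos (hf : IsTopForm e f) {w : Fin n → W} (hw : LinearIndependent ℍ[ℝ]ᵐᵒᵖ w) :
    0 < f (∏ i, sqElt (w i)) := by
  obtain ⟨b, rfl⟩ := exists_basis_eq_of_linearIndependent e hw
  obtain ⟨r, hr, hmem⟩ := exists_pos_prod_sqElt_sub_mem e b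
  have h := hf.crossSpan_eq_zero hmem
  rw [map_sub, map_smul, hf.prod_basis, sub_eq_zero, smul_eq_mul, mul_one] at h
  rwa [h]

theorem prod_nonneg (hf : IsTopForm e f) (w : Fin n → W) : 0 ≤ f (∏ i, sqElt (w i)) := by
  by_cases hw : LinearIndependent ℍ[ℝ]ᵐᵒᵖ w
  · exact (hf.prod_pos hw).le
  · simpa using (hf.prod_eq_zero hw 1).ge

theorem sub_mem_crossSpan (hf : IsTopForm e f) {x : SymAlg W} (hx : x ∈ symPow W n) :
    x - f x • ∏ i, sqElt (e i) ∈ crossSpan W n := by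
  obtain ⟨a, ha, c, hc, rfl⟩ := Submodule.mem_sup.1 (symPow_le_span_sup_crossSpan e hx)
  obtain ⟨t, rfl⟩ := Submodule.mem_span_singleton.1 ha
  rwa [map_add, map_smul, hf.prod_basis, hf.crossSpan_eq_zero hc, smul_eq_mul, mul_one, add_zero,
    add_sub_cancel_left]

theorem mem_crossSpan_iff (hf : IsTopForm e f) {x : SymAlg W} (hx : x ∈ symPow W n) :
    x ∈ crossSpan W n ↔ f x = 0 := by
  refine ⟨hf.crossSpan_eq_zero, fun h => ?_⟩
  have hsub := hf.sub_mem_crossSpan hx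
  rwa [h, zero_smul, sub_zero] at hsub

theorem isInvariantHyperplane_ker (hf : IsTopForm e f) :
    IsInvariantHyperplane W n (LinearMap.ker (f ∘ₗ (symPow W n).subtype)) := by
  refine ⟨fun g x hx => ?_, ?_⟩
  · have hx' : (x : SymAlg W) ∈ crossSpan W n := (hf.mem_crossSpan_iff x.2).2 hx
    have h := hf.symAlgMap_crossSpan_eq_zero g.toLinearMap hx' 1
    rwa [mul_one] at h
  · rw [(LinearMap.quotKerEquivOfSurjective _ hf.surjective).finrank_eq, Module.finrank_self]

end IsTopForm

namespace IsInvariantHyperplane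

variable [IsScalarTower ℝ ℍ[ℝ]ᵐᵒᵖ W] {N : Submodule ℝ (symPow W n)}

theorem ne_top (hN : IsInvariantHyperplane W n N) : N ≠ ⊤ := by
  rintro rfl
  have h := hN.2
  rw [Module.finrank_zero_of_subsingleton] at h
  exact zero_ne_one h

theorem prod_notMem (hN : IsInvariantHyperplane W n N) (b : Module.Basis (Fin n) ℍ[ℝ]ᵐᵒᵖ W) :
    (⟨∏ i, sqElt (b i), prod_sqElt_mem b⟩ : symPow W n) ∉ N := by
  intro h
  have hn : Module.finrank ℍ[ℝ]ᵐᵒᵖ W = n := by simp [Module.finrank_eq_card_basis b]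
  suffices hle : symPow W n ≤ N.map (symPow W n).subtype by
    refine hN.ne_top (eq_top_iff.2 fun x _ => ?_)
    obtain ⟨y, hy, hxy⟩ := hle x.2
    rwa [← Subtype.ext hxy]
  conv_lhs => rw [symPow_eq_span_linearIndependent hn.ge]
  refine Submodule.span_le.2 ?_
  rintro _ ⟨u, hu, rfl⟩
  obtain ⟨b', rfl⟩ := exists_basis_eq_of_linearIndependent b hu
  refine ⟨_, hN.1 (b.equiv b' (Equiv.refl _)) _ h, ?_⟩
  refine (symAlgMap_prod_sqElt (b.equiv b' (Equiv.refl _)).toLinearMap Finset.univ b).trans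
    (Finset.prod_congr rfl fun k _ => ?_)
  rw [LinearEquiv.coe_coe, b.equiv_apply, Equiv.refl_apply]

theorem symElt_basis_mul_prod_mem (hN : IsInvariantHyperplane W n N)
    (b : Module.Basis (Fin n) ℍ[ℝ]ᵐᵒᵖ W) {i : Fin n} {y : W} (hy : b.repr y i = 0) :
    ⟨_, symElt_mul_prod_erase_mem b i (b i) y⟩ ∈ N := by
  obtain ⟨g, hgi, hg⟩ := exists_reflection b i
  have hgk {k : Fin n} (hk : k ≠ i) : g (b k) = b k :=
    hg _ (Submodule.subset_span ⟨k, hk, rfl⟩)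
  refine mem_of_map_eq_neg (g := symPowMap g.toLinearMap n) hN.2 (hN.1 g) (hN.prod_notMem b)
    (Subtype.ext ?_) (Subtype.ext ?_)
  · refine (symAlgMap_prod_sqElt g.toLinearMap Finset.univ b).trans
      (Finset.prod_congr rfl fun k _ => ?_)
    rcases eq_or_ne k i with rfl | hk
    · rw [LinearEquiv.coe_coe, hgi, sqElt_neg]
    · rw [LinearEquiv.coe_coe, hgk hk]
  · change symAlgMap g.toLinearMap (symElt (b i) y * ∏ k ∈ Finset.univ.erase i, sqElt (b k)) =
      -(symElt (b i) y * ∏ k ∈ Finset.univ.erase i, sqElt (b k))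
    have hprod : ∏ k ∈ Finset.univ.erase i, sqElt (g (b k)) =
        ∏ k ∈ Finset.univ.erase i, sqElt (b k) :=
      Finset.prod_congr rfl fun k hk => by rw [hgk (Finset.ne_of_mem_erase hk)]
    rw [map_mul, symAlgMap_symElt, symAlgMap_prod_sqElt, LinearEquiv.coe_coe, hprod, hgi,
      hg y ((mem_span_image_compl_iff b).2 hy), map_neg, LinearMap.neg_apply, neg_mul]

theorem symElt_mul_prod_mem_of_repr_ne_zero (hN : IsInvariantHyperplane W n N)
    (b : Module.Basis (Fin n) ℍ[ℝ]ᵐᵒᵖ W) {i : Fin n} {x y : W} (hx : b.repr x i ≠ 0)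
    (hy : b.repr y i = 0) : ⟨_, symElt_mul_prod_erase_mem b i x y⟩ ∈ N := by
  obtain ⟨b', hb'⟩ := exists_basis_eq_update b hx
  have hne {k : Fin n} (hk : k ≠ i) : b' k = b k := by rw [hb', Function.update_of_ne hk]
  have hi : b' i = x := by rw [hb', Function.update_self]
  have hy' : b'.repr y i = 0 := by
    rw [← mem_span_image_compl_iff] at hy ⊢
    rwa [show b' '' {i}ᶜ = b '' {i}ᶜ from Set.image_congr fun k hk => hne hk]
  convert hN.symElt_basis_mul_prod_mem b' hy' using 3
  · rw [hi]
  · exact Finset.prod_congr rfl fun k hk => by rw [hne (Finset.ne_of_mem_erase hk)]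

theorem crossSpan_le (hN : IsInvariantHyperplane W n N) :
    crossSpan W n ≤ N.map (symPow W n).subtype := by
  refine Submodule.span_le.2 ?_
  rintro _ ⟨b, i, x, y, hy, rfl⟩
  have mem_of_ne_zero {x : W} (hx : b.repr x i ≠ 0) : symElt x y *
      ∏ k ∈ Finset.univ.erase i, sqElt (b k) ∈ N.map (symPow W n).subtype :=
    ⟨_, hN.symElt_mul_prod_mem_of_repr_ne_zero b hx hy, rfl⟩
  by_cases hx : b.repr x i = 0
  · rw [← add_sub_cancel_right x (b i), map_sub, LinearMap.sub_apply, sub_mul]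
    exact sub_mem (mem_of_ne_zero (by simp [hx])) (mem_of_ne_zero (by simp))
  · exact mem_of_ne_zero hx

end IsInvariantHyperplane

namespace IsTopForm

variable [IsScalarTower ℝ ℍ[ℝ]ᵐᵒᵖ W]

theorem eq_ker (hf : IsTopForm e f) {N : Submodule ℝ (symPow W n)}
    (hN : IsInvariantHyperplane W n N) : N = LinearMap.ker (f ∘ₗ (symPow W n).subtype) := by
  have hle : LinearMap.ker (f ∘ₗ (symPow W n).subtype) ≤ N := fun x hx => by
    obtain ⟨y, hy, hxy⟩ := hN.crossSpan_le ((hf.mem_crossSpan_iff x.2).2 hx)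
    rwa [← Subtype.ext hxy]
  exact ((LinearMap.isCoatom_ker_of_surjective hf.surjective).le_iff.1 hle).resolve_left hN.ne_top

theorem mooreKernel_eq_ker (hf : IsTopForm e f) :
    mooreKernel W n = LinearMap.ker (f ∘ₗ (symPow W n).subtype) :=
  le_antisymm (sInf_le hf.isInvariantHyperplane_ker) (le_sInf fun _ hN => (hf.eq_ker hN).ge)

theorem mem_leftKernel (hf : IsTopForm e f) {k l : ℕ} (hkl : k + l = n) {x : symPow W k} :
    x ∈ leftKernel W k ↔ ∀ y : symPow W l, f (x * y) = 0 := by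
  subst hkl
  have hn : k + l = Module.finrank ℍ[ℝ]ᵐᵒᵖ W := by simp [Module.finrank_eq_card_basis e]
  have mem_iff (y : symPow W l) : symMul x y ∈ mooreKernel W (k + l) ↔ f (x * y) = 0 := by
    rw [hf.mooreKernel_eq_ker]
    rfl
  refine ⟨fun h y => (mem_iff y).1 (h l hn y), fun h m hm y => ?_⟩
  obtain rfl : m = l := by omega
  exact (mem_iff y).2 (h y)

end IsTopForm

end TopForm

/-! ### Hyperhermitian matrices -/

namespace HypHerm

open Matrix

variable {n : ℕ}

/-- The sesquilinear form `∑ x̄_i a_{ij} y_j`. -/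
def form (A : HypHerm n) (x y : Fin n → ℍ[ℝ]) : ℍ[ℝ] := star x ⬝ᵥ A.1 *ᵥ y

theorem star_apply (A : HypHerm n) (i j : Fin n) : star (A.1 i j) = A.1 j i := (A.2 j i).symm

theorem star_form (A : HypHerm n) (x y : Fin n → ℍ[ℝ]) : star (form A x y) = form A y x := by
  have hA : A.1ᴴ = A.1 := Matrix.ext fun i j => star_apply A j i
  rw [form, ← star_dotProduct_star, star_star, star_mulVec, hA, ← dotProduct_mulVec, form]

theorem form_add_left (A : HypHerm n) (x x' y : Fin n → ℍ[ℝ]) :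
    form A (x + x') y = form A x y + form A x' y := by
  rw [form, star_add, add_dotProduct, form, form]

theorem form_add_right (A : HypHerm n) (x y y' : Fin n → ℍ[ℝ]) :
    form A x (y + y') = form A x y + form A x y' := by
  rw [form, mulVec_add, dotProduct_add, form, form]

theorem form_single_left (A : HypHerm n) (p : Fin n) (s : ℍ[ℝ]) (y : Fin n → ℍ[ℝ]) :
    form A (Pi.single p s) y = star s * (A.1 *ᵥ y) p := by
  rw [form, ← Pi.single_star, single_dotProduct]

theorem form_self (A : HypHerm n) (x : Fin n → ℍ[ℝ]) :
    form A x x = ((form A x x).re : ℍ[ℝ]) :=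
  Quaternion.star_eq_self.1 (star_form A x x)

theorem apply_self (A : HypHerm n) (p : Fin n) : A.1 p p = ((A.1 p p).re : ℍ[ℝ]) :=
  Quaternion.star_eq_self.1 (star_apply A p p)

theorem form_single_single (A : HypHerm n) (p : Fin n) (s : ℍ[ℝ]) :
    form A (Pi.single p s) (Pi.single p s) = (((A.1 p p).re * Quaternion.normSq s : ℝ) : ℍ[ℝ]) := by
  rw [form_single_left, mulVec_single, Pi.smul_apply, col_apply, MulOpposite.smul_eq_mul_unop,
    unop_op, apply_self A p, Quaternion.re_coe, Quaternion.coe_mul, ← Quaternion.star_mul_self,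
    Quaternion.coe_commutes, ← mul_assoc, Quaternion.coe_commutes]

theorem mem_nonnegCone {A : HypHerm n} : A ∈ nonnegCone n ↔ ∀ x, 0 ≤ (form A x x).re := by
  have form_eq : ∀ x, ∑ i, ∑ j, star (x i) * A.1 i j * x j = form A x x := fun x => by
    simp only [form, dotProduct, mulVec, Finset.mul_sum, mul_assoc, Pi.star_apply]
  refine forall_congr' fun x => ?_
  rw [form_eq]
  refine ⟨?_, fun h => ⟨_, h, form_self A x⟩⟩
  rintro ⟨r, hr, h⟩
  rwa [h, Quaternion.re_coe]

theorem re_form_add_single (A : HypHerm n) (p : Fin n) (s : ℍ[ℝ]) (x : Fin n → ℍ[ℝ]) :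
    (form A (x + Pi.single p s) (x + Pi.single p s)).re = (form A x x).re +
      2 * (star s * (A.1 *ᵥ x) p).re + (A.1 p p).re * Quaternion.normSq s := by
  rw [form_add_left, form_add_right, form_add_right, form_single_single,
    ← star_form A (Pi.single p s) x, form_single_left]
  simp only [Quaternion.re_add, Quaternion.re_coe, Quaternion.re_star]
  ring

/-- The matrix `x x^*`. -/
def rankOne (x : Fin n → ℍ[ℝ]) : HypHerm n :=
  ⟨vecMulVec x (star x), fun i j => by simp [vecMulVec_apply]⟩

theorem rankOne_apply (x : Fin n → ℍ[ℝ]) (i j : Fin n) :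
    (rankOne x).1 i j = x i * star (x j) := rfl

theorem form_rankOne (x y : Fin n → ℍ[ℝ]) :
    form (rankOne x) y y = ((Quaternion.normSq (star x ⬝ᵥ y) : ℝ) : ℍ[ℝ]) := by
  rw [form, rankOne, vecMulVec_mulVec, dotProduct_smul, MulOpposite.smul_eq_mul_unop, unop_op,
    star_dotProduct, Quaternion.star_mul_self]

theorem rankOne_mem (x : Fin n → ℍ[ℝ]) : rankOne x ∈ nonnegCone n :=
  mem_nonnegCone.2 fun y => by
    rw [form_rankOne, Quaternion.re_coe]
    exact Quaternion.normSq_nonneg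

theorem apply_self_nonneg {A : HypHerm n} (hA : A ∈ nonnegCone n) (p : Fin n) :
    0 ≤ (A.1 p p).re := by
  have h := mem_nonnegCone.1 hA (Pi.single p 1)
  rwa [form_single_single, Quaternion.re_coe, map_one, mul_one] at h

theorem row_eq_zero {A : HypHerm n} (hA : A ∈ nonnegCone n) {p : Fin n} (hp : (A.1 p p).re = 0)
    (j : Fin n) : A.1 p j = 0 := by
  by_contra hne
  set c := (A.1 j j).re with hc
  set N := Quaternion.normSq (A.1 p j) with hN
  have hpos : 0 < N := Quaternion.normSq_nonneg.lt_of_ne' (Quaternion.normSq_ne_zero.2 hne)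
  have h := mem_nonnegCone.1 hA (Pi.single j 1 + Pi.single p (-((c + 1) / N) • A.1 p j))
  rw [re_form_add_single, form_single_single, mulVec_single_one, col_apply, hp,
    Quaternion.star_smul, smul_mul_assoc, Quaternion.re_smul, Quaternion.star_mul_self,
    Quaternion.re_coe, Quaternion.re_coe, map_one, ← hc, ← hN, smul_eq_mul, neg_mul,
    div_mul_cancel₀ _ hpos.ne'] at h
  linarith [apply_self_nonneg hA j]

theorem eq_zero_of_diag_eq_zero {A : HypHerm n} (hA : A ∈ nonnegCone n)
    (h : ∀ p, (A.1 p p).re = 0) : A = 0 :=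
  Subtype.ext (Matrix.ext fun p => row_eq_zero hA (h p))

/-- The Schur complement of the `p`-th diagonal entry, padded with zeros to a matrix of the same
size. -/
def schurComplement (A : HypHerm n) (p : Fin n) : HypHerm n :=
  A - (A.1 p p).re⁻¹ • rankOne fun i => A.1 i p

theorem schurComplement_apply (A : HypHerm n) (p i j : Fin n) :
    (schurComplement A p).1 i j = A.1 i j - (A.1 p p).re⁻¹ • (A.1 i p * A.1 p j) := by
  rw [schurComplement, Submodule.coe_sub, Submodule.coe_smul, Matrix.sub_apply, Matrix.smul_apply,
    rankOne_apply, star_apply]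

theorem schurComplement_apply_self_left {A : HypHerm n} {p : Fin n} (hp : (A.1 p p).re ≠ 0)
    (j : Fin n) : (schurComplement A p).1 p j = 0 := by
  rw [schurComplement_apply, apply_self A p, Quaternion.re_coe, Quaternion.coe_mul_eq_smul,
    smul_smul, inv_mul_cancel₀ hp, one_smul, sub_self]

theorem re_form_schurComplement (A : HypHerm n) (p : Fin n) (x : Fin n → ℍ[ℝ]) :
    (form (schurComplement A p) x x).re =
      (form A x x).re - (A.1 p p).re⁻¹ * Quaternion.normSq ((A.1 *ᵥ x) p) := by
  have hrow : star (fun i => A.1 i p) ⬝ᵥ x = (A.1 *ᵥ x) p :=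
    Finset.sum_congr rfl fun i _ => congrArg (· * x i) (star_apply A i p)
  rw [form, schurComplement, Submodule.coe_sub, Submodule.coe_smul, sub_mulVec, dotProduct_sub,
    smul_mulVec, dotProduct_smul, ← form, ← form, form_rankOne, hrow, Quaternion.re_sub,
    Quaternion.re_smul, Quaternion.re_coe, smul_eq_mul]

-- Minimising the form over the `p`-th coordinate leaves the form of the Schur complement.
theorem schurComplement_mem {A : HypHerm n} (hA : A ∈ nonnegCone n) {p : Fin n}
    (hp : 0 < (A.1 p p).re) : schurComplement A p ∈ nonnegCone n := by
  refine mem_nonnegCone.2 fun x => ?_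
  rw [re_form_schurComplement]
  set r := (A.1 p p).re with hr
  have h := mem_nonnegCone.1 hA (x + Pi.single p (-r⁻¹ • (A.1 *ᵥ x) p))
  rw [re_form_add_single, ← hr, Quaternion.star_smul, smul_mul_assoc, Quaternion.re_smul,
    Quaternion.star_mul_self, Quaternion.re_coe, smul_eq_mul, Quaternion.normSq_smul] at h
  convert h using 1
  field_simp
  ring

theorem smul_rankOne_mem_hull {c : ℝ} (hc : 0 ≤ c) (x : Fin n → ℍ[ℝ]) :
    c • rankOne x ∈ PointedCone.hull ℝ (Set.range (rankOne (n := n))) :=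
  PointedCone.smul_mem _ hc (PointedCone.subset_hull ⟨x, rfl⟩)

theorem mem_hull_rankOne_of_rows_eq_zero (S : Finset (Fin n)) {A : HypHerm n}
    (hA : A ∈ nonnegCone n) (hS : ∀ i ∉ S, ∀ j, A.1 i j = 0) :
    A ∈ PointedCone.hull ℝ (Set.range (rankOne (n := n))) := by
  induction S using Finset.induction_on generalizing A with
  | empty =>
    rw [show A = 0 from Subtype.ext (Matrix.ext fun i j => hS i (Finset.notMem_empty i) j)]
    exact zero_mem _
  | insert p S _ ih =>
    rcases (apply_self_nonneg hA p).eq_or_lt with h0 | hpos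
    · refine ih hA fun i hi j => ?_
      rcases eq_or_ne i p with rfl | hip
      · exact row_eq_zero hA h0.symm j
      · exact hS i (by simp [hip, hi]) j
    · have hschur := ih (schurComplement_mem hA hpos) fun i hi j => by
        rcases eq_or_ne i p with rfl | hip
        · exact schurComplement_apply_self_left hpos.ne' j
        · have hrow := hS i (by simp [hip, hi])
          rw [schurComplement_apply, hrow, hrow, zero_mul, smul_zero, sub_zero]
      rw [← sub_add_cancel A ((A.1 p p).re⁻¹ • rankOne fun i => A.1 i p)]
      exact add_mem hschur (smul_rankOne_mem_hull (inv_nonneg.2 hpos.le) _)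

/-- The trace form as a bilinear form. -/
def traceBilin (n : ℕ) : LinearMap.BilinForm ℝ (HypHerm n) :=
  LinearMap.mk₂ ℝ traceForm
    (fun A B C => by simp [traceForm, add_mul, Finset.sum_add_distrib])
    (fun c A B => by simp [traceForm, ← Finset.smul_sum])
    (fun A B C => by simp [traceForm, mul_add, Finset.sum_add_distrib])
    (fun c A B => by simp [traceForm, ← Finset.smul_sum])

theorem traceBilin_apply (A B : HypHerm n) : traceBilin n A B = traceForm A B := rfl

theorem re_mul_comm (p q : ℍ[ℝ]) : (p * q).re = (q * p).re := by
  simp only [Quaternion.re_mul]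
  ring

theorem re_sum (f : Fin n → ℍ[ℝ]) : (∑ i, f i).re = ∑ i, (f i).re :=
  map_sum (QuaternionAlgebra.reₗ (R := ℝ) (-1) 0 (-1)) f Finset.univ

theorem traceForm_comm (A B : HypHerm n) : traceForm A B = traceForm B A := by
  simp only [traceForm, Matrix.mul_apply, re_sum, re_mul_comm (A.1 _ _)]
  exact Finset.sum_comm

theorem traceForm_rankOne (A : HypHerm n) (x : Fin n → ℍ[ℝ]) :
    traceForm A (rankOne x) = (form A x x).re := by
  simp only [traceForm, rankOne, mul_vecMulVec, vecMulVec_apply, form, dotProduct, re_sum,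
    re_mul_comm ((A.1 *ᵥ x) _)]

theorem coe_dual_rankOne :
    (PointedCone.dual (traceBilin n) (Set.range rankOne) : Set (HypHerm n)) = nonnegCone n := by
  ext A
  simp only [SetLike.mem_coe, PointedCone.mem_dual, Set.forall_mem_range, mem_nonnegCone,
    traceBilin_apply, traceForm_comm _ A, traceForm_rankOne]

theorem coe_hull_rankOne :
    (↑(PointedCone.hull ℝ (Set.range (rankOne (n := n)))) : Set (HypHerm n)) = nonnegCone n := by
  refine Set.Subset.antisymm ?_ fun A hA =>
    mem_hull_rankOne_of_rows_eq_zero Finset.univ hA fun i hi => absurd (Finset.mem_univ i) hi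
  rw [← coe_dual_rankOne]
  refine Submodule.span_le.2 ?_
  rintro _ ⟨x, rfl⟩
  rw [coe_dual_rankOne]
  exact rankOne_mem x

theorem coe_dual_nonnegCone :
    (PointedCone.dual (traceBilin n) (nonnegCone n) : Set (HypHerm n)) = nonnegCone n := by
  rw [← coe_hull_rankOne, PointedCone.dual_hull, coe_dual_rankOne, coe_hull_rankOne]

theorem eq_zero_of_traceForm_rankOne {A : HypHerm n} (h : ∀ x, traceForm A (rankOne x) = 0) :
    A = 0 := by
  simp only [traceForm_rankOne] at h
  refine eq_zero_of_diag_eq_zero (mem_nonnegCone.2 fun x => (h x).ge) fun p => ?_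
  have hp := h (Pi.single p 1)
  rwa [form_single_single, Quaternion.re_coe, map_one, mul_one] at hp

theorem traceBilin_nondegenerate (n : ℕ) : (traceBilin n).Nondegenerate :=
  ⟨fun _ hA => eq_zero_of_traceForm_rankOne fun _ => hA _,
    fun _ hA => eq_zero_of_traceForm_rankOne fun _ => (traceForm_comm _ _).trans (hA _)⟩

theorem span_range_rankOne : Submodule.span ℝ (Set.range (rankOne (n := n))) = ⊤ := by
  by_contra hne
  obtain ⟨g, hg, hle⟩ := Submodule.exists_le_ker_of_lt_top _ (lt_top_iff_ne_top.2 hne)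
  obtain ⟨A, rfl⟩ := ((traceBilin n).toDual (traceBilin_nondegenerate n)).surjective g
  refine hg ?_
  rw [eq_zero_of_traceForm_rankOne (A := A) fun x => hle (Submodule.subset_span ⟨x, rfl⟩),
    map_zero]

end HypHerm

/-! ### The conjugate dual -/

section ConjDual

variable {V : Type u} [AddCommGroup V] [Module ℍ[ℝ]ᵐᵒᵖ V] {n : ℕ}

/-- The evaluation `φ ↦ φ(v)`. -/
def ConjDual.eval (v : V) : ConjDual V →ₗ[ℝ] ℍ[ℝ] where
  toFun φ := (show V →ₗ[ℍ[ℝ]ᵐᵒᵖ] ℍ[ℝ] from φ) v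
  map_add' _ _ := rfl
  map_smul' _ _ := rfl

theorem ConjDual.eval_op_smul (q : ℍ[ℝ]) (φ : ConjDual V) (v : V) :
    eval v (op q • φ) = star q * eval v φ := rfl

theorem ConjDual.ext_basis (b : Module.Basis (Fin n) ℍ[ℝ]ᵐᵒᵖ V) {φ ψ : ConjDual V}
    (h : ∀ i, eval (b i) φ = eval (b i) ψ) : φ = ψ :=
  b.ext h

variable (b : Module.Basis (Fin n) ℍ[ℝ]ᵐᵒᵖ V)

theorem eval_basis_coordForm (i j : Fin n) :
    ConjDual.eval (b j) (coordForm b i) = if i = j then 1 else 0 := by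
  change unop (b.repr (b j) i) = _
  rw [b.repr_self, Finsupp.single_apply]
  split_ifs <;> simp_all

theorem eval_basis_sum_smul_coordForm (q : Fin n → ℍ[ℝ]) (j : Fin n) :
    ConjDual.eval (b j) (∑ i, op (q i) • coordForm b i) = star (q j) := by
  simp [map_sum, ConjDual.eval_op_smul, eval_basis_coordForm]

theorem sum_star_eval_smul_coordForm (φ : ConjDual V) :
    ∑ i, op (star (ConjDual.eval (b i) φ)) • coordForm b i = φ :=
  ConjDual.ext_basis b fun j => by rw [eval_basis_sum_smul_coordForm, star_star]

theorem linearIndependent_coordForm : LinearIndependent ℍ[ℝ]ᵐᵒᵖ (coordForm b) := by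
  rw [Fintype.linearIndependent_iff]
  intro c hc j
  have h := eval_basis_sum_smul_coordForm b (unop ∘ c) j
  simp only [Function.comp_apply, op_unop, hc, map_zero] at h
  exact unop_injective (star_eq_zero.1 h.symm)

/-- The coordinates as a basis of the conjugate dual. -/
def coordBasis : Module.Basis (Fin n) ℍ[ℝ]ᵐᵒᵖ (ConjDual V) :=
  Module.Basis.mk (linearIndependent_coordForm b) fun φ _ => by
    rw [← sum_star_eval_smul_coordForm b φ]
    exact sum_mem fun i _ => Submodule.smul_mem _ _ (Submodule.subset_span ⟨i, rfl⟩)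

@[simp]
theorem coe_coordBasis : ⇑(coordBasis b) = coordForm b := Module.Basis.coe_mk _ _

theorem coordBasis_repr_apply (φ : ConjDual V) (i : Fin n) :
    (coordBasis b).repr φ i = op (star (ConjDual.eval (b i) φ)) := by
  nth_rw 1 [← sum_star_eval_smul_coordForm b φ, ← coe_coordBasis]
  exact congrFun ((coordBasis b).repr_sum_self _) i

theorem eval_sum_smul_basis (x : Fin n → ℍ[ℝ]) (φ : ConjDual V) :
    ConjDual.eval (∑ i, op (x i) • b i) φ = ∑ i, ConjDual.eval (b i) φ * x i := by
  refine (map_sum (show V →ₗ[ℍ[ℝ]ᵐᵒᵖ] ℍ[ℝ] from φ) _ _).trans (Finset.sum_congr rfl fun i _ => ?_)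
  exact (show V →ₗ[ℍ[ℝ]ᵐᵒᵖ] ℍ[ℝ] from φ).map_smul (op (x i)) (b i)

theorem matrixForm_rankOne (q : Fin n → ℍ[ℝ]) :
    matrixForm b (HypHerm.rankOne q) = sqTensor (∑ i, op (q i) • coordForm b i) := by
  refine Subtype.ext ?_
  change (balancedRel (ConjDual V)).mkQ
      (∑ i, ∑ j, coordForm b i ⊗ₜ leftSMul (q i * star (q j)) (coordForm b j)) = _
  rw [coe_sqTensor, TensorProduct.sum_tmul, map_sum, map_sum]
  refine Finset.sum_congr rfl fun i _ => ?_
  rw [TensorProduct.tmul_sum, map_sum, map_sum]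
  refine Finset.sum_congr rfl fun j _ => ?_
  rw [mkQ_op_smul_tmul, ← mul_smul, ← op_mul]
  change _ = (balancedRel (ConjDual V)).mkQ (_ ⊗ₜ leftSMul (star (q j * star (q i))) _)
  rw [star_mul, star_star]

theorem matrixForm_id : matrixForm b (HypHerm.id n) = ∑ i, sqTensor (coordForm b i) := by
  have leftSMul_one_apply : ∀ i j, leftSMul ((HypHerm.id n).1 i j) (coordForm b j) =
      if i = j then coordForm b j else 0 := fun i j => LinearMap.ext fun v => by
    change (1 : Matrix (Fin n) (Fin n) ℍ[ℝ]) i j * _ = _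
    split_ifs with h
    · rw [h, Matrix.one_apply_eq, one_mul]
    · rw [Matrix.one_apply_ne h, zero_mul]
      rfl
  refine Subtype.ext ?_
  change (balancedRel (ConjDual V)).mkQ (∑ i, ∑ j, _) = _
  simp only [leftSMul_one_apply, TensorProduct.tmul_ite, Finset.sum_ite_eq, Finset.mem_univ,
    if_true, map_sum, Submodule.coe_sum, coe_sqTensor]

theorem exists_conjDualMap_coordForm_eq {k : ℕ} (w : Fin k → ConjDual V) :
    ∃ (U : Type u) (_ : AddCommGroup U) (_ : Module ℍ[ℝ]ᵐᵒᵖ U)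
      (b' : Module.Basis (Fin k) ℍ[ℝ]ᵐᵒᵖ U) (g : V →ₗ[ℍ[ℝ]ᵐᵒᵖ] U),
      ∀ i, conjDualMap g (coordForm b' i) = w i := by
  refine ⟨ULift.{u} (Fin k → ℍ[ℝ]ᵐᵒᵖ), inferInstance, inferInstance,
    (Pi.basisFun ℍ[ℝ]ᵐᵒᵖ (Fin k)).map ULift.moduleEquiv.symm,
    ULift.moduleEquiv.symm.toLinearMap ∘ₗ LinearMap.pi fun i =>
      { toFun := fun v => op (ConjDual.eval v (w i))
        map_add' := fun x y => congrArg op (map_add (show V →ₗ[ℍ[ℝ]ᵐᵒᵖ] ℍ[ℝ] from w i) x y)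
        map_smul' := fun q x =>
          congrArg op (map_smul (show V →ₗ[ℍ[ℝ]ᵐᵒᵖ] ℍ[ℝ] from w i) q x) }, fun i => ?_⟩
  refine LinearMap.ext fun v => ?_
  change unop (((Pi.basisFun ℍ[ℝ]ᵐᵒᵖ (Fin k)).map ULift.moduleEquiv.symm).repr _ i) = _
  simp only [Module.Basis.map_repr, LinearEquiv.trans_apply, LinearEquiv.symm_symm,
    LinearMap.comp_apply, LinearEquiv.coe_coe, LinearEquiv.apply_symm_apply,
    Pi.basisFun_repr, LinearMap.pi_apply]
  rfl

end ConjDual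

/-! ### The top degree and the pairing of complementary degrees -/

section RSpace

variable {W : Type u} [AddCommGroup W] [Module ℝ W] [Module ℍ[ℝ]ᵐᵒᵖ W]
  [IsScalarTower ℝ ℍ[ℝ]ᵐᵒᵖ W] {k l n : ℕ}

/-- The class of `∏ i, [w_i ⊗ w_i]` in `R^k(W)`. -/
def sqProd (w : Fin k → W) : RSpace W k :=
  (leftKernel W k).mkQ ⟨∏ i, sqElt (w i), prod_sqElt_mem w⟩

theorem span_range_sqProd : Submodule.span ℝ (Set.range (sqProd (W := W) (k := k))) = ⊤ := by
  refine eq_top_iff.2 fun ω _ => ?_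
  obtain ⟨x, rfl⟩ := Submodule.mkQ_surjective _ ω
  obtain ⟨y, hy, hyx⟩ : (x : SymAlg W) ∈ (Submodule.span ℝ (Set.range fun w : Fin k → W =>
      (⟨∏ i, sqElt (w i), prod_sqElt_mem w⟩ : symPow W k))).map (symPow W k).subtype := by
    rw [Submodule.map_span, ← Set.range_comp]
    exact (symPow_eq_span k).le x.2
  rw [← Subtype.ext hyx]
  have h := Submodule.mem_map_of_mem (f := (leftKernel W k).mkQ) hy
  rwa [Submodule.map_span, ← Set.range_comp] at h

/-- The product `R^k(W) × R^l(W) → R^{k+l}(W)` as a bilinear map. -/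
def RSpace.mulBilin : RSpace W k →ₗ[ℝ] RSpace W l →ₗ[ℝ] RSpace W (k + l) :=
  have eq_mkQ {m : ℕ} (ω : RSpace W m) : ∃ x, (leftKernel W m).mkQ x = ω :=
    Submodule.mkQ_surjective _ ω
  LinearMap.mk₂ ℝ RSpace.mul
    (fun a b c => by
      obtain ⟨x, rfl⟩ := eq_mkQ a
      obtain ⟨y, rfl⟩ := eq_mkQ b
      obtain ⟨z, rfl⟩ := eq_mkQ c
      exact congrArg (leftKernel W (k + l)).mkQ
        (Subtype.ext (add_mul x.1 y.1 z.1) : symMul (x + y) z = symMul x z + symMul y z))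
    (fun r a b => by
      obtain ⟨x, rfl⟩ := eq_mkQ a
      obtain ⟨y, rfl⟩ := eq_mkQ b
      exact congrArg (leftKernel W (k + l)).mkQ
        (Subtype.ext (smul_mul_assoc r x.1 y.1) : symMul (r • x) y = r • symMul x y))
    (fun a b c => by
      obtain ⟨x, rfl⟩ := eq_mkQ a
      obtain ⟨y, rfl⟩ := eq_mkQ b
      obtain ⟨z, rfl⟩ := eq_mkQ c
      exact congrArg (leftKernel W (k + l)).mkQ
        (Subtype.ext (mul_add x.1 y.1 z.1) : symMul x (y + z) = symMul x y + symMul x z))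
    (fun r a b => by
      obtain ⟨x, rfl⟩ := eq_mkQ a
      obtain ⟨y, rfl⟩ := eq_mkQ b
      exact congrArg (leftKernel W (k + l)).mkQ
        (Subtype.ext (mul_smul_comm r x.1 y.1) : symMul x (r • y) = r • symMul x y))

theorem mulBilin_sqProd_sqProd (w : Fin k → W) (w' : Fin l → W) :
    RSpace.mulBilin (sqProd w) (sqProd w') = sqProd (Fin.append w w') := by
  refine congrArg (leftKernel W (k + l)).mkQ (Subtype.ext ?_)
  change (∏ i, sqElt (w i)) * ∏ i, sqElt (w' i) = ∏ i, sqElt (Fin.append w w' i)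
  simp only [Fin.prod_univ_add, Fin.append_left, Fin.append_right]

namespace IsTopForm

variable {e : Module.Basis (Fin n) ℍ[ℝ]ᵐᵒᵖ W} {f : SymAlg W →ₗ[ℝ] ℝ}

theorem mem_leftKernel_top (hf : IsTopForm e f) (x : symPow W n) :
    x ∈ leftKernel W n ↔ f x = 0 := by
  rw [hf.mem_leftKernel (add_zero n)]
  refine ⟨fun h => ?_, fun h ⟨y, hy⟩ => ?_⟩
  · simpa using h ⟨1, by rw [symPow, pow_zero]; exact Submodule.mem_one.2 ⟨1, map_one _⟩⟩
  · rw [symPow, pow_zero] at hy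
    obtain ⟨r, rfl⟩ := Submodule.mem_one.1 hy
    rw [mul_comm, ← Algebra.smul_def, map_smul, h, smul_zero]

/-- The functional on `R^n(W)`, `n = dim_ℍ W`, induced by a top form. -/
def topVal (hf : IsTopForm e f) : RSpace W n →ₗ[ℝ] ℝ :=
  (leftKernel W n).liftQ (f ∘ₗ (symPow W n).subtype) fun x hx => (hf.mem_leftKernel_top x).1 hx

theorem topVal_mkQ (hf : IsTopForm e f) (x : symPow W n) :
    hf.topVal ((leftKernel W n).mkQ x) = f x := rfl

theorem topVal_injective (hf : IsTopForm e f) : Function.Injective hf.topVal := by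
  rw [injective_iff_map_eq_zero]
  intro ω h
  obtain ⟨x, rfl⟩ := Submodule.mkQ_surjective _ ω
  exact (Submodule.Quotient.mk_eq_zero _).2 ((hf.mem_leftKernel_top x).2 h)

theorem eq_zero_of_mulBilin_eq_zero {e : Module.Basis (Fin (k + l)) ℍ[ℝ]ᵐᵒᵖ W}
    (hf : IsTopForm e f) {η : RSpace W k} (h : ∀ ζ : RSpace W l, RSpace.mulBilin η ζ = 0) :
    η = 0 := by
  obtain ⟨x, rfl⟩ := Submodule.mkQ_surjective _ η
  refine (Submodule.Quotient.mk_eq_zero _).2 ((hf.mem_leftKernel rfl).2 fun y => ?_)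
  have hxy := congrArg hf.topVal (h ((leftKernel W l).mkQ y))
  rw [map_zero] at hxy
  exact hxy

theorem mkQ_symPowMap {W' : Type v} [AddCommGroup W'] [Module ℝ W'] [Module ℍ[ℝ]ᵐᵒᵖ W']
    [IsScalarTower ℝ ℍ[ℝ]ᵐᵒᵖ W'] {e : Module.Basis (Fin (k + l)) ℍ[ℝ]ᵐᵒᵖ W}
    {e' : Module.Basis (Fin k) ℍ[ℝ]ᵐᵒᵖ W'} {f' : SymAlg W' →ₗ[ℝ] ℝ} (hf : IsTopForm e f)
    (hf' : IsTopForm e' f') (g : W' →ₗ[ℍ[ℝ]ᵐᵒᵖ] W) (x : symPow W' k) :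
    (leftKernel W k).mkQ (symPowMap g k x) =
      hf'.topVal ((leftKernel W' k).mkQ x) • sqProd fun i => g (e' i) := by
  rw [hf'.topVal_mkQ, sqProd, ← map_smul, ← sub_eq_zero, ← map_sub]
  refine (Submodule.Quotient.mk_eq_zero _).2 ((hf.mem_leftKernel rfl).2 fun y => ?_)
  have h := hf.symAlgMap_crossSpan_eq_zero g (hf'.sub_mem_crossSpan x.2) y
  rwa [map_sub, map_smul, symAlgMap_prod_sqElt] at h

end IsTopForm

end RSpace

section TopEquiv

variable {V : Type u} [AddCommGroup V] [Module ℍ[ℝ]ᵐᵒᵖ V] {n : ℕ}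
  (b : Module.Basis (Fin n) ℍ[ℝ]ᵐᵒᵖ V)

theorem idPow_eq_sum (m : ℕ) :
    idPow b m = ∑ p : Fin m → Fin n, sqProd fun i => coordForm b (p i) := by
  simp only [sqProd]
  rw [← map_sum]
  refine congrArg (Omega.mk m) (Subtype.ext ?_)
  rw [Submodule.coe_sum]
  change _ ^ m = ∑ p : Fin m → Fin n, ∏ i, sqElt (coordForm b (p i))
  rw [matrixForm_id, map_sum]
  exact Fintype.sum_pow _ m

theorem IsTopForm.topVal_idPow_pos {e : Module.Basis (Fin n) ℍ[ℝ]ᵐᵒᵖ (ConjDual V)}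
    {f : SymAlg (ConjDual V) →ₗ[ℝ] ℝ} (hf : IsTopForm e f) : 0 < hf.topVal (idPow b n) := by
  rw [idPow_eq_sum, map_sum]
  exact Finset.sum_pos' (fun p _ => hf.prod_nonneg _)
    ⟨id, Finset.mem_univ _, hf.prod_pos (linearIndependent_coordForm b)⟩

/-- The isomorphism `Ω^{n,n}(V) ≃ ℝ` that takes `[Id]^n` to `1`. -/
def topEquiv : Omega V n ≃ₗ[ℝ] ℝ :=
  have hf := (exists_isTopForm (coordBasis b)).choose_spec
  have hpos := hf.topVal_idPow_pos b
  LinearEquiv.ofBijective ((hf.topVal (idPow b n))⁻¹ • hf.topVal)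
    ⟨fun _ _ h => hf.topVal_injective (mul_left_cancel₀ (inv_ne_zero hpos.ne') h),
      fun r => ⟨r • idPow b n, by
        rw [map_smul, LinearMap.smul_apply, smul_eq_mul, smul_eq_mul, inv_mul_cancel₀ hpos.ne',
          mul_one]⟩⟩

@[simp]
theorem topEquiv_idPow : topEquiv b (idPow b n) = 1 :=
  inv_mul_cancel₀ ((exists_isTopForm (coordBasis b)).choose_spec.topVal_idPow_pos b).ne'

theorem topEquiv_sqProd_nonneg (w : Fin n → ConjDual V) : 0 ≤ topEquiv b (sqProd w) := by
  have hf := (exists_isTopForm (coordBasis b)).choose_spec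
  exact mul_nonneg (inv_nonneg.2 (hf.topVal_idPow_pos b).le) (hf.prod_nonneg w)

theorem topEquiv_sqProd_pos {w : Fin n → ConjDual V} (hw : LinearIndependent ℍ[ℝ]ᵐᵒᵖ w) :
    0 < topEquiv b (sqProd w) := by
  have hf := (exists_isTopForm (coordBasis b)).choose_spec
  exact mul_pos (inv_pos.2 (hf.topVal_idPow_pos b)) (hf.prod_pos hw)

theorem topEquiv_idPow_nonneg (b' : Module.Basis (Fin n) ℍ[ℝ]ᵐᵒᵖ V) :
    0 ≤ topEquiv b (idPow b' n) := by
  rw [idPow_eq_sum, map_sum]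
  exact Finset.sum_nonneg fun _ _ => topEquiv_sqProd_nonneg b _

theorem mem_topNonneg {ω : Omega V n} : ω ∈ topNonneg V n ↔ 0 ≤ topEquiv b ω := by
  constructor
  · rintro ⟨b', t, ht, rfl⟩
    rw [map_smul]
    exact mul_nonneg ht (topEquiv_idPow_nonneg b b')
  · refine fun h => ⟨b, topEquiv b ω, h, (topEquiv b).injective ?_⟩
    rw [map_smul, topEquiv_idPow, smul_eq_mul, mul_one]

theorem topEquiv_sqProd_update (b' : Module.Basis (Fin n) ℍ[ℝ]ᵐᵒᵖ V) (i : Fin n)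
    (φ : ConjDual V) :
    topEquiv b (sqProd (Function.update (coordForm b') i φ)) =
      Quaternion.normSq (ConjDual.eval (b' i) φ) * topEquiv b (sqProd (coordForm b')) := by
  have hf := (exists_isTopForm (coordBasis b)).choose_spec
  have h := hf.crossSpan_eq_zero (prod_sqElt_update_sub_mem (coordBasis b') i φ)
  rw [coordBasis_repr_apply, unop_op, Quaternion.normSq_star, coe_coordBasis, map_sub, map_smul,
    sub_eq_zero] at h
  exact (congrArg _ h).trans (mul_left_comm _ _ _)

end TopEquiv

/-! ### Strongly and weakly positive elements -/

section Cones

variable {V : Type u} [AddCommGroup V] [Module ℍ[ℝ]ᵐᵒᵖ V] {k l n : ℕ}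

theorem mem_simplePositive (b : Module.Basis (Fin (k + l)) ℍ[ℝ]ᵐᵒᵖ V) {η : Omega V k} :
    η ∈ simplePositive V k ↔
      ∃ (t : ℝ) (w : Fin k → ConjDual V), 0 ≤ t ∧ η = t • sqProd w := by
  obtain ⟨f, hf⟩ := exists_isTopForm (coordBasis b)
  constructor
  · rintro ⟨U, _, _, _, g, ξ, -, ⟨b', t, ht, rfl⟩, x, hx, rfl⟩
    obtain ⟨f', hf'⟩ := exists_isTopForm (coordBasis b')
    refine ⟨_, _, ?_, hf.mkQ_symPowMap hf' (conjDualMap g) x⟩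
    change 0 ≤ hf'.topVal (Omega.mk k x)
    rw [hx, map_smul]
    exact mul_nonneg ht (hf'.topVal_idPow_pos b').le
  · rintro ⟨t, w, ht, rfl⟩
    obtain ⟨U, _, _, b', g, hg⟩ := exists_conjDualMap_coordForm_eq w
    obtain ⟨f', hf'⟩ := exists_isTopForm (coordBasis b')
    have hpos := hf'.topVal_idPow_pos b'
    obtain ⟨x, hx⟩ := Submodule.mkQ_surjective (leftKernel (ConjDual U) k)
      ((t / hf'.topVal (idPow b' k)) • idPow b' k)
    refine ⟨U, _, _, Module.Finite.of_basis b', g, _, by simp [Module.finrank_eq_card_basis b'],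
      ⟨b', _, by positivity, rfl⟩, x, hx, (hf.mkQ_symPowMap hf' (conjDualMap g) x).trans ?_⟩
    rw [hx, map_smul, smul_eq_mul, div_mul_cancel₀ _ hpos.ne']
    simp only [coe_coordBasis, hg]

open scoped Pointwise in
theorem coe_hull_sqProd (b : Module.Basis (Fin (k + l)) ℍ[ℝ]ᵐᵒᵖ V) :
    (PointedCone.hull ℝ (Set.range (sqProd (W := ConjDual V) (k := k))) : Set (Omega V k)) =
      strongCone V k := by
  have h : simplePositive V k =
      (Set.univ : Set {c : ℝ // 0 ≤ c}) • Set.range (sqProd (W := ConjDual V) (k := k)) := by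
    ext η
    rw [mem_simplePositive b, Set.mem_smul]
    constructor
    · rintro ⟨t, w, ht, rfl⟩
      exact ⟨⟨t, ht⟩, trivial, _, ⟨w, rfl⟩, rfl⟩
    · rintro ⟨⟨t, ht⟩, -, _, ⟨w, rfl⟩, rfl⟩
      exact ⟨t, w, ht, rfl⟩
  change _ = (AddSubmonoid.closure (simplePositive V k) : Set (Omega V k))
  rw [h]
  exact congrArg SetLike.coe (Submodule.span_eq_closure (R := {c : ℝ // 0 ≤ c}))

/-- The pairing of complementary degrees with values in `Ω^{n,n}(V) ≃ ℝ`. -/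
def pairing (b : Module.Basis (Fin (k + l)) ℍ[ℝ]ᵐᵒᵖ V) : Omega V k →ₗ[ℝ] Omega V l →ₗ[ℝ] ℝ :=
  RSpace.mulBilin.compr₂ (topEquiv b).toLinearMap

theorem pairing_sqProd_sqProd (b : Module.Basis (Fin (k + l)) ℍ[ℝ]ᵐᵒᵖ V) (w : Fin k → ConjDual V)
    (w' : Fin l → ConjDual V) :
    pairing b (sqProd w) (sqProd w') = topEquiv b (sqProd (Fin.append w w')) :=
  congrArg (topEquiv b) (mulBilin_sqProd_sqProd w w')

theorem separatingLeft_pairing (b : Module.Basis (Fin (k + l)) ℍ[ℝ]ᵐᵒᵖ V) :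
    (pairing b).SeparatingLeft := fun _ h =>
  (exists_isTopForm (coordBasis b)).choose_spec.eq_zero_of_mulBilin_eq_zero fun ζ =>
    (topEquiv b).map_eq_zero_iff.1 (h ζ)

theorem coe_dual_sqProd (b : Module.Basis (Fin (k + l)) ℍ[ℝ]ᵐᵒᵖ V) :
    (PointedCone.dual (pairing b).flip (Set.range sqProd) : Set (Omega V k)) = weakCone V k := by
  have hn : k + l = Module.finrank ℍ[ℝ]ᵐᵒᵖ V := by simp [Module.finrank_eq_card_basis b]
  rw [← PointedCone.dual_hull]
  ext η
  rw [coe_hull_sqProd (b.reindex (finCongr (add_comm k l)))]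
  refine ⟨fun h m hm ζ hζ => ?_, fun h ζ hζ => (mem_topNonneg b).1 (h l hn ζ hζ)⟩
  obtain rfl : m = l := by omega
  exact (mem_topNonneg b).2 (h hζ)

theorem strongCone_subset_weakCone (b : Module.Basis (Fin (k + l)) ℍ[ℝ]ᵐᵒᵖ V) :
    strongCone V k ⊆ weakCone V k := by
  rw [← coe_hull_sqProd b, ← coe_dual_sqProd b, SetLike.coe_subset_coe, PointedCone.hull,
    Submodule.span_le]
  rintro _ ⟨w, rfl⟩ _ ⟨w', rfl⟩
  rw [LinearMap.flip_apply, pairing_sqProd_sqProd]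
  exact topEquiv_sqProd_nonneg b _

theorem smul_sqProd_mem_strongCone (b : Module.Basis (Fin (k + l)) ℍ[ℝ]ᵐᵒᵖ V) {t : ℝ}
    (ht : 0 ≤ t) (w : Fin k → ConjDual V) : t • sqProd w ∈ strongCone V k := by
  rw [← coe_hull_sqProd b]
  exact PointedCone.smul_mem _ ht (Submodule.subset_span ⟨w, rfl⟩)

theorem weakCone_eq_strongCone_of_span_singleton_eq_top
    (b : Module.Basis (Fin (k + l)) ℍ[ℝ]ᵐᵒᵖ V) {w : Fin k → ConjDual V} {w' : Fin l → ConjDual V}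
    (hspan : Submodule.span ℝ {sqProd w} = ⊤)
    (hli : LinearIndependent ℍ[ℝ]ᵐᵒᵖ (Fin.append w w')) : weakCone V k = strongCone V k := by
  refine subset_antisymm (fun η hη => ?_) (strongCone_subset_weakCone b)
  obtain ⟨r, rfl⟩ := Submodule.mem_span_singleton.1 (Submodule.eq_top_iff'.1 hspan η)
  refine smul_sqProd_mem_strongCone b ?_ w
  rw [← coe_dual_sqProd b] at hη
  have h := hη ⟨w', rfl⟩
  rw [LinearMap.flip_apply, map_smul, LinearMap.smul_apply, pairing_sqProd_sqProd] at h
  exact nonneg_of_mul_nonneg_left h (topEquiv_sqProd_pos b hli)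

theorem weakCone_zero (b : Module.Basis (Fin n) ℍ[ℝ]ᵐᵒᵖ V) : weakCone V 0 = strongCone V 0 := by
  have b₀ : Module.Basis (Fin (0 + n)) ℍ[ℝ]ᵐᵒᵖ V := b.reindex (finCongr (zero_add n).symm)
  refine weakCone_eq_strongCone_of_span_singleton_eq_top b₀
    (w := fun i => coordForm b₀ (i.castAdd n)) (w' := fun i => coordForm b₀ (i.natAdd 0)) ?_ ?_
  · rw [← span_range_sqProd, Set.range_unique, Subsingleton.elim default]
  · rw [Fin.append_castAdd_natAdd]
    exact linearIndependent_coordForm b₀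

theorem weakCone_top (b : Module.Basis (Fin n) ℍ[ℝ]ᵐᵒᵖ V) : weakCone V n = strongCone V n := by
  refine weakCone_eq_strongCone_of_span_singleton_eq_top (l := 0) b (w := coordForm b)
    (w' := Fin.elim0) ?_ ?_
  · have hpos := topEquiv_sqProd_pos b (linearIndependent_coordForm b)
    refine Submodule.eq_top_iff'.2 fun η => Submodule.mem_span_singleton.2
      ⟨topEquiv b η / topEquiv b (sqProd (coordForm b)), (topEquiv b).injective ?_⟩
    rw [map_smul, smul_eq_mul, div_mul_cancel₀ _ hpos.ne']
  · rw [Fin.append_elim0]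
    exact linearIndependent_coordForm b

theorem mul_comm_mem_topNonneg {η : Omega V k} {ζ : Omega V l}
    (h : RSpace.mul η ζ ∈ topNonneg V (k + l)) : RSpace.mul ζ η ∈ topNonneg V (l + k) := by
  have cast_mem {m m' : ℕ} (hm : m = m') (x : symPow (ConjDual V) m) (y : symPow (ConjDual V) m')
      (hxy : (x : SymAlg (ConjDual V)) = y) (hx : Omega.mk m x ∈ topNonneg V m) :
      Omega.mk m' y ∈ topNonneg V m' := by
    subst hm
    rwa [← Subtype.ext hxy]
  obtain ⟨x, rfl⟩ := Submodule.mkQ_surjective _ η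
  obtain ⟨y, rfl⟩ := Submodule.mkQ_surjective _ ζ
  exact cast_mem (add_comm k l) (symMul x y) (symMul y x) (mul_comm _ _) h

theorem pairing_nonneg (b : Module.Basis (Fin (k + l)) ℍ[ℝ]ᵐᵒᵖ V) {η : Omega V k}
    {ζ : Omega V l} (hη : η ∈ strongCone V k) (hζ : ζ ∈ weakCone V l) : 0 ≤ pairing b η ζ := by
  have hn : l + k = Module.finrank ℍ[ℝ]ᵐᵒᵖ V := by
    simp [Module.finrank_eq_card_basis b, add_comm]
  exact (mem_topNonneg b).1 (mul_comm_mem_topNonneg (hζ k hn η hη))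

end Cones

/-! ### Degrees `1` and `n - 1` -/

section Matrices

variable {V : Type u} [AddCommGroup V] [Module ℍ[ℝ]ᵐᵒᵖ V] {k n : ℕ}

theorem matrixToOmega_rankOne (b : Module.Basis (Fin n) ℍ[ℝ]ᵐᵒᵖ V) (q : Fin n → ℍ[ℝ]) :
    matrixToOmega b (HypHerm.rankOne q) = sqProd fun _ => ∑ i, op (q i) • coordForm b i := by
  refine congrArg (Omega.mk 1) (Subtype.ext ?_)
  change SymmetricAlgebra.ι ℝ _ (matrixForm b (HypHerm.rankOne q)) = ∏ _ : Fin 1, _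
  rw [matrixForm_rankOne, Fin.prod_univ_one, sqElt]

theorem image_range_rankOne (b : Module.Basis (Fin n) ℍ[ℝ]ᵐᵒᵖ V) :
    matrixToOmega b '' Set.range HypHerm.rankOne = Set.range sqProd := by
  rw [← Set.range_comp]
  refine subset_antisymm ?_ ?_
  · rintro _ ⟨q, rfl⟩
    exact ⟨_, (matrixToOmega_rankOne b q).symm⟩
  · rintro _ ⟨w, rfl⟩
    refine ⟨fun i => star (ConjDual.eval (b i) (w 0)),
      (matrixToOmega_rankOne b _).trans (congrArg sqProd (funext fun j => ?_))⟩
    rw [sum_star_eval_smul_coordForm, Subsingleton.elim 0 j]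

theorem matrixToOmega_surjective (b : Module.Basis (Fin n) ℍ[ℝ]ᵐᵒᵖ V) :
    Function.Surjective (matrixToOmega b) := by
  rw [← LinearMap.range_eq_top, eq_top_iff, ← span_range_sqProd, ← image_range_rankOne b,
    Submodule.span_le]
  rintro _ ⟨A, -, rfl⟩
  exact LinearMap.mem_range_self _ A

theorem image_nonnegCone_eq_strongCone (b : Module.Basis (Fin (k + 1)) ℍ[ℝ]ᵐᵒᵖ V) :
    matrixToOmega b '' nonnegCone (k + 1) = strongCone V 1 := by
  rw [← HypHerm.coe_hull_rankOne, ← coe_hull_sqProd (b.reindex (finCongr (add_comm k 1))),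
    ← image_range_rankOne b]
  exact congrArg SetLike.coe (Submodule.map_span
    ((matrixToOmega b).restrictScalars {c : ℝ // 0 ≤ c}) (Set.range HypHerm.rankOne))

theorem pairing_sqProd_init (b b' : Module.Basis (Fin (k + 1)) ℍ[ℝ]ᵐᵒᵖ V) (φ : ConjDual V) :
    pairing b (sqProd (Fin.init (coordForm b'))) (sqProd fun _ : Fin 1 => φ) =
      Quaternion.normSq (ConjDual.eval (b' (Fin.last k)) φ) *
        topEquiv b (sqProd (coordForm b')) := by
  rw [pairing_sqProd_sqProd, Fin.append_right_eq_snoc, ← topEquiv_sqProd_update,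
    ← Fin.update_snoc_last, Fin.snoc_init_self]

theorem exists_pairing_matrixToOmega_eq_traceForm (b : Module.Basis (Fin (k + 1)) ℍ[ℝ]ᵐᵒᵖ V)
    (x : Fin (k + 1) → ℍ[ℝ]) :
    ∃ η ∈ strongCone V k, ∀ A : HypHerm (k + 1),
      pairing b η (matrixToOmega b A) = traceForm A (HypHerm.rankOne x) := by
  rcases eq_or_ne x 0 with rfl | hx
  · refine ⟨0, zero_mem (AddSubmonoid.closure (simplePositive V k)), fun A => ?_⟩
    simp [HypHerm.traceForm_rankOne, HypHerm.form]
  have hv : ∑ i, op (x i) • b i ≠ 0 := fun h => hx <| funext fun i =>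
    op_injective (Fintype.linearIndependent_iff.1 b.linearIndependent _ h i)
  obtain ⟨b', hb'⟩ := exists_basis_apply_eq b (Fin.last k) hv
  have hpos := topEquiv_sqProd_pos b (linearIndependent_coordForm b')
  refine ⟨(topEquiv b (sqProd (coordForm b')))⁻¹ • sqProd (Fin.init (coordForm b')),
    smul_sqProd_mem_strongCone b (inv_pos.2 hpos).le _, fun A => ?_⟩
  suffices h : pairing b _ ∘ₗ matrixToOmega b =
      (HypHerm.traceBilin (k + 1)).flip (HypHerm.rankOne x) from LinearMap.congr_fun h A
  refine LinearMap.ext_on_range HypHerm.span_range_rankOne fun q => ?_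
  calc
    pairing b _ (matrixToOmega b (HypHerm.rankOne q))
    _ = Quaternion.normSq (ConjDual.eval (b' (Fin.last k)) (∑ i, op (q i) • coordForm b i)) := by
      rw [matrixToOmega_rankOne, map_smul, LinearMap.smul_apply, pairing_sqProd_init, smul_eq_mul,
        mul_comm, mul_inv_cancel_right₀ hpos.ne']
    _ = Quaternion.normSq (star q ⬝ᵥ x) := by
      rw [hb', eval_sum_smul_basis]
      simp only [eval_basis_sum_smul_coordForm, dotProduct, Pi.star_apply]
    _ = traceForm (HypHerm.rankOne q) (HypHerm.rankOne x) := by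
      rw [HypHerm.traceForm_rankOne, HypHerm.form_rankOne, Quaternion.re_coe]

theorem matrixToOmega_injective (b : Module.Basis (Fin (k + 1)) ℍ[ℝ]ᵐᵒᵖ V) :
    Function.Injective (matrixToOmega b) := by
  rw [injective_iff_map_eq_zero]
  refine fun A hA => HypHerm.eq_zero_of_traceForm_rankOne fun x => ?_
  obtain ⟨η, -, hη⟩ := exists_pairing_matrixToOmega_eq_traceForm b x
  rw [← hη, hA, map_zero]

theorem image_nonnegCone_eq_weakCone (b : Module.Basis (Fin (k + 1)) ℍ[ℝ]ᵐᵒᵖ V) :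
    matrixToOmega b '' nonnegCone (k + 1) = weakCone V 1 := by
  refine subset_antisymm ?_ fun ζ hζ => ?_
  · rw [image_nonnegCone_eq_strongCone]
    exact strongCone_subset_weakCone (b.reindex (finCongr (add_comm k 1)))
  · obtain ⟨A, rfl⟩ := matrixToOmega_surjective b ζ
    refine ⟨A, ?_, rfl⟩
    rw [← HypHerm.coe_dual_rankOne]
    rintro _ ⟨x, rfl⟩
    obtain ⟨η, hη, hηA⟩ := exists_pairing_matrixToOmega_eq_traceForm b x
    rw [HypHerm.traceBilin_apply, HypHerm.traceForm_comm, ← hηA]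
    exact pairing_nonneg b hη hζ

section DualMatrix

variable (b : Module.Basis (Fin (k + 1)) ℍ[ℝ]ᵐᵒᵖ V)

/-- The map `Ω^{n-1,n-1}(V) → ℋ_n` dual to `A ↦ [A]` with respect to the trace form. -/
def dualMatrix : Omega V k →ₗ[ℝ] HypHerm (k + 1) :=
  ((HypHerm.traceBilin (k + 1)).toDual (HypHerm.traceBilin_nondegenerate (k + 1))).symm ∘ₗ
    (pairing b).compl₂ (matrixToOmega b)

theorem traceForm_dualMatrix (η : Omega V k) (X : HypHerm (k + 1)) :
    traceForm (dualMatrix b η) X = pairing b η (matrixToOmega b X) :=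
  LinearMap.BilinForm.apply_toDual_symm_apply (hB := HypHerm.traceBilin_nondegenerate (k + 1))
    ((pairing b).compl₂ (matrixToOmega b) η) X

theorem exists_dualMatrix_eq_rankOne (x : Fin (k + 1) → ℍ[ℝ]) :
    ∃ η ∈ strongCone V k, dualMatrix b η = HypHerm.rankOne x := by
  obtain ⟨η, hη, h⟩ := exists_pairing_matrixToOmega_eq_traceForm b x
  refine ⟨η, hη, sub_eq_zero.1 ((HypHerm.traceBilin_nondegenerate (k + 1)).1 _ fun A => ?_)⟩
  rw [map_sub, LinearMap.sub_apply, HypHerm.traceBilin_apply, HypHerm.traceBilin_apply,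
    traceForm_dualMatrix, h, HypHerm.traceForm_comm, sub_self]

theorem dualMatrix_injective : Function.Injective (dualMatrix b) := by
  rw [injective_iff_map_eq_zero]
  refine fun η hη => separatingLeft_pairing b η fun ζ => ?_
  obtain ⟨X, rfl⟩ := matrixToOmega_surjective b ζ
  rw [← traceForm_dualMatrix, hη, ← HypHerm.traceBilin_apply, map_zero, LinearMap.zero_apply]

theorem dualMatrix_surjective : Function.Surjective (dualMatrix b) := by
  rw [← LinearMap.range_eq_top, eq_top_iff, ← HypHerm.span_range_rankOne, Submodule.span_le]
  rintro _ ⟨x, rfl⟩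
  obtain ⟨η, -, hη⟩ := exists_dualMatrix_eq_rankOne b x
  exact ⟨η, hη⟩

/-- The isomorphism `Ω^{n-1,n-1}(V) ≃ ℋ_n` given by `dualMatrix`. -/
def dualMatrixEquiv : Omega V k ≃ₗ[ℝ] HypHerm (k + 1) :=
  LinearEquiv.ofBijective (dualMatrix b) ⟨dualMatrix_injective b, dualMatrix_surjective b⟩

theorem dualMatrix_mem_nonnegCone {η : Omega V k} (hη : η ∈ weakCone V k) :
    dualMatrix b η ∈ nonnegCone (k + 1) := by
  rw [← coe_dual_sqProd b] at hη
  rw [← HypHerm.coe_dual_rankOne]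
  rintro _ ⟨x, rfl⟩
  rw [HypHerm.traceBilin_apply, HypHerm.traceForm_comm, traceForm_dualMatrix,
    matrixToOmega_rankOne]
  exact hη ⟨_, rfl⟩

theorem nonnegCone_subset_image_strongCone :
    nonnegCone (k + 1) ⊆ dualMatrix b '' strongCone V k := by
  have h : PointedCone.hull ℝ (Set.range HypHerm.rankOne) ≤
      (PointedCone.hull ℝ (Set.range sqProd)).map (dualMatrix b) := by
    refine Submodule.span_le.2 ?_
    rintro _ ⟨x, rfl⟩
    obtain ⟨η, hη, hx⟩ := exists_dualMatrix_eq_rankOne b x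
    rw [← coe_hull_sqProd b] at hη
    exact ⟨η, hη, hx⟩
  rw [← HypHerm.coe_hull_rankOne, ← coe_hull_sqProd b]
  exact h

theorem dualMatrix_image_strongCone : dualMatrix b '' strongCone V k = nonnegCone (k + 1) :=
  subset_antisymm (Set.image_subset_iff.2 fun _ hη =>
    dualMatrix_mem_nonnegCone b (strongCone_subset_weakCone b hη))
    (nonnegCone_subset_image_strongCone b)

theorem dualMatrix_image_weakCone : dualMatrix b '' weakCone V k = nonnegCone (k + 1) :=
  subset_antisymm (Set.image_subset_iff.2 fun _ => dualMatrix_mem_nonnegCone b) <|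
    (nonnegCone_subset_image_strongCone b).trans (Set.image_mono (strongCone_subset_weakCone b))

end DualMatrix

theorem weakCone_eq_strongCone_of_succ (b : Module.Basis (Fin (k + 1)) ℍ[ℝ]ᵐᵒᵖ V) :
    weakCone V k = strongCone V k :=
  (dualMatrix_injective b).image_injective <|
    (dualMatrix_image_weakCone b).trans (dualMatrix_image_strongCone b).symm

end Matrices

end QuatForms

end

theorem proposition2p2p4 {V : Type u} [AddCommGroup V] [Module ℍ[ℝ]ᵐᵒᵖ V]
    [Module.Finite ℍ[ℝ]ᵐᵒᵖ V] (n : ℕ) (hn : Module.finrank ℍ[ℝ]ᵐᵒᵖ V = n) :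
    -- the two cones coincide in the degrees `0, 1, n - 1, n`
    (∀ k : ℕ, k ≤ n → (k = 0 ∨ k = 1 ∨ k + 1 = n ∨ k = n) → weakCone V k = strongCone V k) ∧
    -- the cone of non-negative hyperhermitian matrices is self-dual
    (nonnegCone n = {X : HypHerm n | ∀ Y ∈ nonnegCone n, 0 ≤ traceForm X Y}) ∧
    -- degree `1`: identification with hyperhermitian matrices through any basis of `V`
    (1 ≤ n → ∀ b : Module.Basis (Fin n) ℍ[ℝ]ᵐᵒᵖ V,
      Function.Bijective (matrixToOmega b) ∧
      matrixToOmega b '' nonnegCone n = strongCone V 1 ∧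
      matrixToOmega b '' nonnegCone n = weakCone V 1) ∧
    -- degree `n - 1`: `Ω^{n,n}(V) ≃ ℝ` with `(Id)^n ↦ 1`, and `Ω^{n-1,n-1}(V) ≃ (ℋ_n)^* ≃ ℋ_n`
    -- by the product with `Ω^{1,1}(V)` and the trace form
    (∀ k : ℕ, k + 1 = n → ∀ b : Module.Basis (Fin n) ℍ[ℝ]ᵐᵒᵖ V,
      ∃ (τ : Omega V (k + 1) ≃ₗ[ℝ] ℝ) (Ψ : Omega V k ≃ₗ[ℝ] HypHerm n),
        τ (idPow b (k + 1)) = 1 ∧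
        (∀ (η : Omega V k) (X : HypHerm n),
          τ (RSpace.mul η (matrixToOmega b X)) = traceForm (Ψ η) X) ∧
        Ψ '' strongCone V k = nonnegCone n ∧
        Ψ '' weakCone V k = nonnegCone n) := by
  have b : Module.Basis (Fin n) ℍ[ℝ]ᵐᵒᵖ V := Module.finBasisOfFinrankEq _ _ hn
  refine ⟨?_, ?_, ?_, ?_⟩
  · rintro k hkn (rfl | rfl | rfl | rfl)
    · exact weakCone_zero b
    · obtain ⟨m, rfl⟩ := Nat.exists_eq_add_of_le' hkn
      rw [← image_nonnegCone_eq_weakCone b, image_nonnegCone_eq_strongCone b]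
    · exact weakCone_eq_strongCone_of_succ b
    · exact weakCone_top b
  · refine HypHerm.coe_dual_nonnegCone.symm.trans (Set.ext fun X => forall₂_congr fun Y _ => ?_)
    rw [HypHerm.traceBilin_apply, HypHerm.traceForm_comm]
  · intro h1 b
    obtain ⟨m, rfl⟩ := Nat.exists_eq_add_of_le' h1
    exact ⟨⟨matrixToOmega_injective b, matrixToOmega_surjective b⟩,
      image_nonnegCone_eq_strongCone b, image_nonnegCone_eq_weakCone b⟩
  · rintro k rfl b
    exact ⟨topEquiv b, dualMatrixEquiv b, topEquiv_idPow b,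
      fun η X => (traceForm_dualMatrix b η X).symm, dualMatrix_image_strongCone b,
      dualMatrix_image_weakCone b⟩
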